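/- **Conventions.** Automata are finite, deterministic and complete: $\mathcal A=(S,\Sigma,\iota,F,\delta)$ with $\Sigma$ a finite alphabet; $|\mathcal A|=|S|$, and $L(\mathcal A)$ is the language recognized. $\mathcal A$ is *minimal* if no smaller automaton recognizes $L(\mathcal A)$. A language $L\subseteq\Sigma^*$ is an *ideal* if every word having a (scattered) sub-word in $L$ is in $L$. An *intersection decomposition* of a minimal $\mathcal A$ is a non-empty finite sequence of automata over $\Sigma$, each with fewer than $|\mathcal A|$ states, whose languages intersect to $L(\mathcal A)$; a minimal automaton without one is *intersection-prime*. Write $q\preccurlyeq r$ if $r=\delta(q,w)$ for some word $w$, and $q\prec r$ if moreover $q\ne r$. $\mathcal A$ is *linear* if $\preccurlyeq$ is a total order on $S$. *Family automata.* For a non-linear minimal $\mathcal A$ recognizing an ideal, let $q_{\rm sep}$ be the $\preccurlyeq$-least state $q$ such that $\{r: q\prec r\}$ has no least element, let the rank of a state be the length of a longest path from $\iota$ to it that visits no state twice, and let the separator set consist of the states of rank $\operatorname{rank}(q_{\rm sep})+1$. For $\rho$ in the separator set let $M_\rho=\{q: q\preccurlyeq\rho\text{ or }\rho\preccurlyeq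 q\}$; the automaton $\mathcal A(\rho)$ has states $M_\rho$, initial state $\iota$, accepting states $F\cap M_\rho$, and moves from $q$ by $a$ to $\delta(s,a)$, where $s=\min\{s\in M_\rho: q\preccurlyeq s,\ \delta(s,a)\in M_\rho\}$. *Reduced automata.* For a linear $\mathcal A$ with states $q_0\prec\dots\prec q_n$ and $0\le k\le n-1$, the automaton $\mathcal A_k$ is obtained by removing $q_k$ and redirecting to $q_{k+1}$ all transitions leading to $q_k$ (and the initial arrow if $k=0$). $\mathcal A$ has a damping pattern between $q_{k-1}$ and $q_k$ ($1\le k\le n-1$) if every letter $a$ with $\delta(q_{k-1},a)\in\{q_{k-1},q_k\}$ satisfies $\delta(q_k,a)=q_k$. *Iterated procedure.* A linear automaton without damping pattern is output unchanged. A non-linear $\mathcal A$ is replaced by the $\mathcal A(\rho)$, $\rho$ in the separator set. A linear $\mathcal A$ with a damping pattern between some $q_{k-1}$ and $q_k$ is replaced by $\mathcal A_{k-1}$ and $\mathcal A_k$. Each new automaton is replaced by a minimal automaton of its language, to which the procedure is applied again. **Corollary.** There is an algorithm (a single computable function, uniform in the alphabet) which, given any minimal automaton $\mathcal A$ recognizing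 an ideal, outputs a finite sequence $D$ of automata over the alphabet of $\mathcal A$ that is a result of the iterated procedure on $\mathcal A$, such that 1. $D$ has at most $2^{2|\mathcal A|}$ members; 2. each member of $D$ is intersection-prime and recognizes an ideal; 3. $L(\mathcal A)=\bigcap_{\mathcal B\in D}L(\mathcal B)$; and $D$ is an intersection decomposition of $\mathcal A$ if $\mathcal A$ is not intersection-prime, while $D=(\mathcal A)$ if $\mathcal A$ is intersection-prime. -/

import Mathlib

namespace IdealAutomata

/-! ### Ideals and the accessibility relation -/

/-- A language is an ideal if every upper-word of one of its words belongs to it. A word `u` is a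
sub-word of `v`, that is `v ∈ u ⧢ Σ*`, iff `u` is a sublist of `v`. -/
def IsIdeal {α : Type} (L : Language α) : Prop :=
  ∀ u ∈ L, ∀ v : List α, u.Sublist v → v ∈ L

section Order

variable {α σ : Type} (A : DFA α σ)

/-- `q ≼ r`: the state `r` is accessible from the state `q`. -/
def Le (q r : σ) : Prop := ∃ w : List α, A.evalFrom q w = r

/-- `q ≺ r`. -/
def Lt (q r : σ) : Prop := Le A q r ∧ q ≠ r

/-- `A` is linear: accessibility is a total order on the states (it is always reflexive and
transitive). -/
def IsLinear : Prop :=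
  (∀ q r, Le A q r → Le A r q → q = r) ∧ ∀ q r, Le A q r ∨ Le A r q

/-- `m` is the least element of the set of states `X` for accessibility. -/
def IsLeastState (X : Set σ) (m : σ) : Prop := m ∈ X ∧ ∀ x ∈ X, Le A m x

/-- `r` is the immediate successor of `q`. -/
def IsNext (q r : σ) : Prop := Lt A q r ∧ ¬ ∃ s, Lt A q s ∧ Lt A s r

end Order

/-! ### Non-linear automata: separator state, separator set, family automata -/

section NonLinear

variable {α σ : Type} (A : DFA α σ)

/-- The states whose strict successors have no least element. -/
def branchingStates : Set σ := {q | ¬ ∃ m, IsLeastState A {r | Lt A q r} m}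

/-- The separator state: the least branching state. -/
def IsSeparatorState (s : σ) : Prop := IsLeastState A (branchingStates A) s

/-- The rank of `q`: the length of a longest path from the initial state to `q` that does not
visit a state twice. -/
noncomputable def rank (q : σ) : ℕ :=
  sSup {n | ∃ w : List α, w.length = n ∧ A.eval w = q ∧ (List.scanl A.step A.start w).Nodup}

/-- The separator set: the states whose rank is one more than that of the separator state. -/
def separatorSet : Set σ := {q | ∃ s, IsSeparatorState A s ∧ rank A q = rank A s + 1}

/-- The family of `ρ`: its ancestors and its descendants. -/
def family (ρ : σ) : Set σ := {q | Le A q ρ ∨ Le A ρ q}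

/-- `C` is the family automaton of `A` at `ρ`: its states are the family of `ρ`, its initial and
accepting states are those of `A`, and it moves from `q` by the letter `a` to `δ(s, a)`, where `s` is
the least state of the family with `q ≼ s` and `δ(s, a)` in the family. -/
def IsFamilyAutomaton (ρ : σ) (C : DFA α (family A ρ)) : Prop :=
  (C.start : σ) = A.start ∧
  (∀ q : family A ρ, q ∈ C.accept ↔ (q : σ) ∈ A.accept) ∧
  ∀ (q : family A ρ) (a : α), ∃ s : σ,
    IsLeastState A {t | t ∈ family A ρ ∧ Le A q t ∧ A.step t a ∈ family A ρ} s ∧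
    (C.step q a : σ) = A.step s a

end NonLinear

/-! ### Linear automata: damping patterns, reduced automata -/

section Linear

variable {α σ : Type} (A : DFA α σ)

/-- A damping pattern between consecutive states `p`, `q`, the second of which is not the last
state (its immediate successor is `r`): each letter that fixes `p` or leads from `p` to `q`
fixes `q`. -/
def IsDampingPattern (p q r : σ) : Prop :=
  IsNext A p q ∧ IsNext A q r ∧ ∀ a, A.step p a = p ∨ A.step p a = q → A.step q a = q

/-- `C` is the reduced automaton obtained from `A` by removing the state `q` and redirecting to its
immediate successor `r` the transitions heading to `q` (and the initial arrow if `q` is initial). -/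
def IsReducedAutomaton (q r : σ) (C : DFA α {x : σ // x ≠ q}) : Prop :=
  ((A.start = q ∧ (C.start : σ) = r) ∨ (A.start ≠ q ∧ (C.start : σ) = A.start)) ∧
  (∀ x : {x : σ // x ≠ q}, x ∈ C.accept ↔ (x : σ) ∈ A.accept) ∧
  ∀ (x : {x : σ // x ≠ q}) (a : α),
    (A.step x a = q ∧ (C.step x a : σ) = r) ∨
    (A.step x a ≠ q ∧ (C.step x a : σ) = A.step x a)

end Linear

/-! ### Finite automata, minimality, intersection decompositions, primality -/

/-- A finite complete deterministic automaton over the alphabet `α`. Its states are named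
`0, …, size - 1`. -/
structure FinAut (α : Type) where
  size : ℕ
  step : Fin size → α → Fin size
  start : Fin size
  accept : Finset (Fin size)

namespace FinAut

variable {α : Type}

/-- The underlying automaton, as Mathlib's `DFA`. -/
def toDFA (A : FinAut α) : DFA α (Fin A.size) where
  step := A.step
  start := A.start
  accept := {q | q ∈ A.accept}

/-- The language recognized by `A`. -/
def language (A : FinAut α) : Language α := A.toDFA.accepts

/-- No smaller automaton recognizes the same language. -/
def IsMinimal (A : FinAut α) : Prop :=
  ∀ B : FinAut α, B.language = A.language → A.size ≤ B.size

/-- The language of `A` is the intersection of the languages of the members of `D`. -/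
def IsIntersection (A : FinAut α) (D : List (FinAut α)) : Prop :=
  ∀ w : List α, w ∈ A.language ↔ ∀ B ∈ D, w ∈ B.language

/-- `D` is an intersection decomposition of `A`: a finite non-empty sequence of automata, each
smaller than `A`, the intersection of whose languages is the language of `A`. -/
def IsInterDecomposition (A : FinAut α) (D : List (FinAut α)) : Prop :=
  D ≠ [] ∧ (∀ B ∈ D, B.size < A.size) ∧ A.IsIntersection D

/-- A minimal automaton is prime for intersection if it has no intersection decomposition. -/
def IsInterPrime (A : FinAut α) : Prop :=
  A.IsMinimal ∧ ¬ ∃ D, A.IsInterDecomposition D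

end FinAut

/-! ### The iterated decomposition procedure -/

/-- `IteratedDecomposition A D`: the sequence `D` is an output of the iterated decomposition
procedure on `A`.
* A linear automaton without damping pattern is left as it is.
* A non-linear automaton is replaced by (minimal automata of the languages of) its family automata
  at the states of the separator set, and the procedure goes on with each of these.
* A linear automaton with a damping pattern between `p` and `q` is replaced by (minimal automata of
  the languages of) its two reduced automata, in which `p`, respectively `q`, is removed, and the
  procedure goes on with both of these. -/
inductive IteratedDecomposition {α : Type} : FinAut α → List (FinAut α) → Prop
  | linearNoDamping (A : FinAut α)
      (hlin : IsLinear A.toDFA)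
      (hdamp : ¬ ∃ p q r, IsDampingPattern A.toDFA p q r) :
      IteratedDecomposition A [A]
  | nonLinear (A : FinAut α)
      (hlin : ¬ IsLinear A.toDFA)
      (seps : List (Fin A.size)) (hnodup : seps.Nodup)
      (hseps : ∀ ρ, ρ ∈ seps ↔ ρ ∈ separatorSet A.toDFA)
      (B : Fin A.size → FinAut α) (D : Fin A.size → List (FinAut α))
      (hB : ∀ ρ ∈ seps, (B ρ).IsMinimal ∧
        ∃ C, IsFamilyAutomaton A.toDFA ρ C ∧ (B ρ).language = C.accepts)
      (hD : ∀ ρ ∈ seps, IteratedDecomposition (B ρ) (D ρ)) :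
      IteratedDecomposition A (seps.flatMap D)
  | linear (A : FinAut α)
      (hlin : IsLinear A.toDFA)
      (p q r : Fin A.size) (hdamp : IsDampingPattern A.toDFA p q r)
      (B₁ B₂ : FinAut α) (D₁ D₂ : List (FinAut α))
      (hB₁ : B₁.IsMinimal ∧ ∃ C, IsReducedAutomaton A.toDFA p q C ∧ B₁.language = C.accepts)
      (hB₂ : B₂.IsMinimal ∧ ∃ C, IsReducedAutomaton A.toDFA q r C ∧ B₂.language = C.accepts)
      (hD₁ : IteratedDecomposition B₁ D₁) (hD₂ : IteratedDecomposition B₂ D₂) :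
      IteratedDecomposition A (D₁ ++ D₂)

/-! ### Automata as inputs and outputs of an algorithm -/

/-- Concrete data describing an automaton: number of letters, number of states, initial state,
for each state whether it is accepting, and for each state the row of its transition table. -/
abbrev Code : Type := ℕ × ℕ × ℕ × List Bool × List (List ℕ)

/-- The description of an automaton over the alphabet `{0, …, k - 1}`. -/
def FinAut.code {k : ℕ} (A : FinAut (Fin k)) : Code :=
  (k, A.size, (A.start : ℕ),
    List.ofFn (fun q : Fin A.size => decide (q ∈ A.accept)),
    List.ofFn (fun q : Fin A.size => List.ofFn (fun a : Fin k => (A.step q a : ℕ))))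

end IdealAutomata

namespace IdealAutomata

/-! ### Automata whose residual languages are distinct and increasing -/

section Residuals

variable {α σ : Type} {A : DFA α σ}

/-! In a minimal automaton of an ideal, the states are the residual languages, and these grow along
transitions; hence accessibility is a partial order (`FinAut.IsMinimal.isReducedIdeal`). Three facts
then drive the procedure.

Non-linear case. States below the separator `s` are comparable with every state, and the separator
set consists of the immediate successors of `s`. The run of a rejected word either stays below `s`
or enters the cone above some successor `r`; the family automaton of `r` copies that run and rejects
too (`exists_not_mem_family`). There are `t ≥ 2` successors, and each family misses the other `t -
1`.

Linear case, damping between `p` and `q`. Removing a state only enlarges the language. While `A`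
waits in `p`, the automaton without `p` is in `q` and the one without `q` is in `p`; damping
preserves this. If `A` then moves to `q`, the former agrees with it from there on; if `A` jumps
beyond `q`, the latter does (`mem_acceptsFrom_of_damping`).

Linear case, no damping. Let `B` have fewer states than `A` and a larger language. By the pigeonhole
principle there is a level `x` of `A` such that a state of `B` covering the residual of `x` always
covers that of a strictly later state. Without damping, a word independent of `B` can climb `A`
state by state so that, from `x` on, `B` stays strictly ahead. It leads `A` to its penultimate,
rejecting state, and `B` accepts (`exists_word_of_all_smaller`); so no decomposition exists.

Sizes drop at each replacement, so as many rounds as states suffice, and `t * 4 ^ (n + 1 - t) ≤ 4 ^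
n` yields the length bound. The algorithm consists of bounded searches: a minimal automaton is found
among finitely many candidates by testing words of length at most `n ^ 2`. -/

theorem Le.refl (A : DFA α σ) (q : σ) : Le A q q := ⟨[], rfl⟩

theorem Le.trans {p q r : σ} : Le A p q → Le A q r → Le A p r := by
  rintro ⟨u, rfl⟩ ⟨v, rfl⟩
  exact ⟨u ++ v, A.evalFrom_of_append _ _ _⟩

theorem le_step (A : DFA α σ) (q : σ) (a : α) : Le A q (A.step q a) := ⟨[a], rfl⟩

theorem cons_mem_acceptsFrom {q : σ} {a : α} {w : List α} :
    a :: w ∈ A.acceptsFrom q ↔ w ∈ A.acceptsFrom (A.step q a) := Iff.rfl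

theorem append_mem_acceptsFrom {q : σ} {u w : List α} :
    u ++ w ∈ A.acceptsFrom q ↔ w ∈ A.acceptsFrom (A.evalFrom q u) := by
  rw [DFA.mem_acceptsFrom, DFA.mem_acceptsFrom, DFA.evalFrom_of_append]

/-- All states are accessible, the residual languages of the states are pairwise distinct, and
they increase along transitions. -/
structure IsReducedIdeal (A : DFA α σ) : Prop where
  reach : ∀ q, Le A A.start q
  mono : ∀ q r, Le A q r → ∀ w ∈ A.acceptsFrom q, w ∈ A.acceptsFrom r
  inj : ∀ q r, A.acceptsFrom q = A.acceptsFrom r → q = r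

/-- An upper-word arises by inserting letters one at a time, and each insertion costs one
transition, along which the residual only grows. -/
theorem isIdeal_accepts_of_step {A : DFA α σ}
    (h : ∀ q a, ∀ w ∈ A.acceptsFrom q, w ∈ A.acceptsFrom (A.step q a)) :
    IsIdeal A.accepts := by
  suffices H : ∀ u v : List α, u.Sublist v → ∀ q, u ∈ A.acceptsFrom q → v ∈ A.acceptsFrom q from
    fun u hu v huv => H u v huv _ hu
  intro u v huv
  induction huv with
  | slnil => exact fun _ h => h
  | cons a _ ih => exact fun q hq => ih _ (h q a _ hq)
  | cons_cons a _ ih => exact fun q hq => ih _ hq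

namespace IsReducedIdeal

variable (h : IsReducedIdeal A)
include h

theorem antisymm {q r : σ} (h₁ : Le A q r) (h₂ : Le A r q) : q = r :=
  h.inj _ _ (Set.ext fun w => ⟨h.mono _ _ h₁ w, h.mono _ _ h₂ w⟩)

/-- Accessibility as a partial order on the states. -/
abbrev partialOrder : PartialOrder σ where
  le := Le A
  lt := Lt A
  le_refl := Le.refl A
  le_trans _ _ _ := Le.trans
  le_antisymm _ _ := h.antisymm
  lt_iff_le_not_ge _ _ :=
    ⟨fun hl => ⟨hl.1, fun hr => hl.2 (h.antisymm hl.1 hr)⟩,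
      fun hl => ⟨hl.1, fun e => hl.2 (e ▸ Le.refl A _)⟩⟩

theorem lt_of_lt_of_le {p q r : σ} (h₁ : Lt A p q) (h₂ : Le A q r) : Lt A p r :=
  ⟨h₁.1.trans h₂, fun e => h₁.2 (h.antisymm h₁.1 (e ▸ h₂))⟩

theorem not_le_of_lt {p q : σ} (h₁ : Lt A p q) : ¬ Le A q p :=
  fun h₂ => h₁.2 (h.antisymm h₁.1 h₂)

theorem accept_of_le {p q : σ} (hpq : Le A p q) (hp : p ∈ A.accept) : q ∈ A.accept :=
  h.mono _ _ hpq [] hp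

theorem exists_maximal [Finite σ] (X : Set σ) (hX : X.Nonempty) :
    ∃ t ∈ X, ∀ x ∈ X, Le A t x → x = t := by
  let := h.partialOrder
  obtain ⟨t, ht⟩ := X.toFinite.exists_maximal hX
  exact ⟨t, ht.1, fun x hx htx => h.antisymm (ht.2 hx htx) htx⟩

theorem exists_minimal [Finite σ] (X : Set σ) (hX : X.Nonempty) :
    ∃ t ∈ X, ∀ x ∈ X, Le A x t → x = t := by
  let := h.partialOrder
  obtain ⟨t, ht⟩ := X.toFinite.exists_minimal hX
  exact ⟨t, ht.1, fun x hx hxt => h.antisymm hxt (ht.2 hx hxt)⟩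

theorem exists_isNext_le [Finite σ] {p q : σ} (hpq : Lt A p q) :
    ∃ r, IsNext A p r ∧ Le A r q := by
  obtain ⟨r, ⟨hpr, hrq⟩, hr⟩ :=
    h.exists_minimal {r | Lt A p r ∧ Le A r q} ⟨q, hpq, Le.refl A q⟩
  refine ⟨r, ⟨hpr, ?_⟩, hrq⟩
  rintro ⟨s, hps, hsr⟩
  exact hsr.2 (hr s ⟨hps, hsr.1.trans hrq⟩ hsr.1)

theorem exists_le_isNext [Finite σ] {p q : σ} (hpq : Lt A p q) :
    ∃ r, Le A p r ∧ IsNext A r q := by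
  obtain ⟨r, ⟨hpr, hrq⟩, hr⟩ :=
    h.exists_maximal {r | Le A p r ∧ Lt A r q} ⟨p, Le.refl A p, hpq⟩
  refine ⟨r, hpr, hrq, ?_⟩
  rintro ⟨s, hrs, hsq⟩
  exact hrs.2 (hr s ⟨hpr.trans hrs.1, hsq⟩ hrs.1).symm

omit h in
-- Skip the letters that loop on `p`: the first letter leaving `p` stays below `q`, hence lands on
-- `q`, as nothing lies strictly between.
theorem exists_step_of_isNext {p q : σ} (hpq : IsNext A p q) : ∃ a, A.step p a = q := by
  obtain ⟨⟨⟨w, hw⟩, hne⟩, hn⟩ := hpq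
  induction w with
  | nil => exact absurd hw hne
  | cons a w ih =>
    rw [DFA.evalFrom_cons] at hw
    by_cases ha : A.step p a = p
    · rw [ha] at hw
      exact ih hw
    · refine ⟨a, ?_⟩
      by_contra hq
      exact hn ⟨_, ⟨le_step A p a, Ne.symm ha⟩, ⟨w, hw⟩, hq⟩

end IsReducedIdeal

end Residuals

/-! ### The separator state -/

section Separator

variable {α σ : Type} {A : DFA α σ}

namespace IsReducedIdeal

variable [Finite σ] (h : IsReducedIdeal A)
include h

/-- A maximal lower bound `t` of the branching states is itself branching: otherwise the least
strict successor of `t` would be a larger lower bound. Linearity plays no role, since a last state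
is branching. -/
theorem exists_isSeparatorState : ∃ s, IsSeparatorState A s := by
  obtain ⟨t, ht, hmax⟩ := h.exists_maximal {q | ∀ b ∈ branchingStates A, Le A q b}
    ⟨A.start, fun b _ => h.reach b⟩
  refine ⟨t, ?_, ht⟩
  rintro ⟨m, hm, hleast⟩
  refine hm.2 (hmax m (fun b hb => hleast b ⟨ht b hb, ?_⟩) hm.1).symm
  rintro rfl
  exact hb ⟨m, hm, hleast⟩

/-- Take a maximal common ancestor `t` of `x` and `y`. If it is neither of them, it lies strictly
below `s`, so it is not branching, and its least strict successor is a larger common ancestor. -/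
theorem comparable_of_le_separator {s x y : σ} (hs : IsSeparatorState A s) (hx : Le A x s) :
    Le A x y ∨ Le A y x := by
  obtain ⟨t, ⟨htx, hty⟩, hmax⟩ := h.exists_maximal {t | Le A t x ∧ Le A t y}
    ⟨A.start, h.reach x, h.reach y⟩
  by_cases htx' : t = x
  · exact Or.inl (htx' ▸ hty)
  by_cases hty' : t = y
  · exact Or.inr (hty' ▸ htx)
  exfalso
  have hnb : t ∉ branchingStates A := fun hb =>
    h.not_le_of_lt (h.lt_of_lt_of_le ⟨htx, htx'⟩ hx) (hs.2 t hb)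
  obtain ⟨m, hm, hleast⟩ := not_not.1 hnb
  exact hm.2 (hmax m ⟨hleast x ⟨htx, htx'⟩, hleast y ⟨hty, hty'⟩⟩ hm.1).symm

theorem le_separator_of_lt_of_isNext {s x r : σ} (hs : IsSeparatorState A s) (hr : IsNext A s r)
    (hx : Lt A x r) : Le A x s := by
  rcases h.comparable_of_le_separator hs (Le.refl A s) (y := x) with hsx | hxs
  · by_cases e : s = x
    · exact e ▸ Le.refl A s
    · exact absurd ⟨x, ⟨hsx, e⟩, hx⟩ hr.2
  · exact hxs

theorem separator_lt_of_not_le {s x : σ} (hs : IsSeparatorState A s) (hx : ¬ Le A x s) :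
    Lt A s x :=
  ⟨(h.comparable_of_le_separator hs (Le.refl A s)).resolve_right hx,
    fun e => hx (e ▸ Le.refl A s)⟩

theorem exists_isNext_separator (hlin : ¬ IsLinear A) {s : σ} (hs : IsSeparatorState A s) :
    ∃ r, IsNext A s r := by
  by_contra hno
  refine hlin ⟨fun q r => h.antisymm, fun q r => ?_⟩
  refine h.comparable_of_le_separator hs ?_
  by_contra hq
  obtain ⟨r, hr, -⟩ := h.exists_isNext_le (h.separator_lt_of_not_le hs hq)
  exact hno ⟨r, hr⟩

omit [Finite σ] h in
theorem not_le_of_isNext {s r r' : σ} (hr : IsNext A s r) (hr' : IsNext A s r') (hne : r ≠ r') :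
    ¬ Le A r r' := fun hle => hr'.2 ⟨r, hr.1, hle, hne⟩

/-- A unique immediate successor would be the least strict successor, and `s` would not be
branching. -/
theorem exists_isNext_ne {s r : σ} (hs : IsSeparatorState A s) (hr : IsNext A s r) :
    ∃ r', IsNext A s r' ∧ r' ≠ r := by
  by_contra! hno
  refine hs.1 ⟨r, hr.1, fun x hx => ?_⟩
  obtain ⟨r', hr', hle⟩ := h.exists_isNext_le hx
  exact hno r' hr' ▸ hle

omit [Finite σ] h in
theorem not_mem_family {s r r' : σ} (hr : IsNext A s r) (hr' : IsNext A s r') (hne : r' ≠ r) :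
    r' ∉ family A r := by
  rintro (hle | hle)
  · exact not_le_of_isNext hr' hr hne hle
  · exact not_le_of_isNext hr hr' hne.symm hle

omit [Finite σ] in
theorem separator_unique {s s' : σ} (hs : IsSeparatorState A s) (hs' : IsSeparatorState A s') :
    s = s' := h.antisymm (hs.2 _ hs'.1) (hs'.2 _ hs.1)

end IsReducedIdeal

/-! ### Ranks -/

variable (A) in
/-- Along the word `w`, every letter moves the automaton to another state. -/
def MovesAlong : σ → List α → Prop
  | _, [] => True
  | q, a :: w => A.step q a ≠ q ∧ MovesAlong (A.step q a) w

theorem movesAlong_append {q : σ} {u w : List α} :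
    MovesAlong A q (u ++ w) ↔ MovesAlong A q u ∧ MovesAlong A (A.evalFrom q u) w := by
  induction u generalizing q with
  | nil => simp [MovesAlong]
  | cons a u ih => simp [MovesAlong, ih, and_assoc]

theorem exists_movesAlong {q r : σ} (hqr : Le A q r) :
    ∃ w, A.evalFrom q w = r ∧ MovesAlong A q w := by
  obtain ⟨w, rfl⟩ := hqr
  induction w generalizing q with
  | nil => exact ⟨[], rfl, trivial⟩
  | cons a w ih =>
    rw [DFA.evalFrom_cons]
    obtain ⟨v, hv, hm⟩ := ih (q := A.step q a)
    by_cases ha : A.step q a = q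
    · rw [ha] at hv hm ⊢
      exact ⟨v, hv, hm⟩
    · exact ⟨a :: v, by rw [DFA.evalFrom_cons, hv], ha, hm⟩

theorem le_of_mem_scanl {q r : σ} {w : List α} (hr : r ∈ List.scanl A.step q w) : Le A q r := by
  induction w generalizing q with
  | nil => simp at hr; exact hr ▸ Le.refl A q
  | cons a w ih =>
    rw [List.scanl_cons, List.mem_cons] at hr
    rcases hr with rfl | hr
    · exact Le.refl A _
    · exact (le_step A q a).trans (ih hr)

namespace IsReducedIdeal

variable (h : IsReducedIdeal A)
include h

/-- By antisymmetry a state once left is never visited again, so only consecutive states need to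
differ. -/
theorem nodup_scanl_iff {q : σ} {w : List α} :
    (List.scanl A.step q w).Nodup ↔ MovesAlong A q w := by
  induction w generalizing q with
  | nil => simp [MovesAlong]
  | cons a w ih =>
    rw [List.scanl_cons, List.nodup_cons, ih, MovesAlong]
    refine and_congr_left fun _ => not_congr ⟨fun hm => ?_, fun e => ?_⟩
    · exact h.antisymm (le_of_mem_scanl hm) (le_step A q a)
    · rw [e]; cases w <;> simp

omit h in
-- On an unbounded set of naturals `sSup` is `0`; this bound makes `rank` a genuine maximum.
theorem bddAbove_rank [Finite σ] (q : σ) : BddAbove {n | ∃ w : List α, w.length = n ∧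
    A.eval w = q ∧ (List.scanl A.step A.start w).Nodup} := by
  have := Fintype.ofFinite σ
  refine ⟨Fintype.card σ, ?_⟩
  rintro n ⟨w, rfl, -, hn⟩
  have := hn.length_le_card
  rw [List.length_scanl] at this
  omega

theorem length_le_rank [Finite σ] {w : List α} (hw : MovesAlong A A.start w) :
    w.length ≤ rank A (A.eval w) :=
  le_csSup (bddAbove_rank _) ⟨w, rfl, rfl, h.nodup_scanl_iff.2 hw⟩

theorem exists_length_eq_rank [Finite σ] (q : σ) :
    ∃ w, A.eval w = q ∧ MovesAlong A A.start w ∧ w.length = rank A q := by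
  obtain ⟨v, hv, hm⟩ := exists_movesAlong (h.reach q)
  have hne : {n | ∃ w : List α, w.length = n ∧
      A.eval w = q ∧ (List.scanl A.step A.start w).Nodup}.Nonempty :=
    ⟨_, v, rfl, hv, h.nodup_scanl_iff.2 hm⟩
  obtain ⟨w, hl, hw, hn⟩ := Nat.sSup_mem hne (bddAbove_rank q)
  exact ⟨w, hw, h.nodup_scanl_iff.1 hn, hl⟩

theorem rank_lt_rank [Finite σ] {p q : σ} (hpq : Lt A p q) : rank A p < rank A q := by
  obtain ⟨u, hu, hum, hul⟩ := h.exists_length_eq_rank p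
  obtain ⟨v, hv, hvm⟩ := exists_movesAlong hpq.1
  have hvne : v ≠ [] := by
    rintro rfl
    exact hpq.2 hv
  have hu' : A.evalFrom A.start u = p := hu
  have hm : MovesAlong A A.start (u ++ v) := movesAlong_append.2 ⟨hum, hu'.symm ▸ hvm⟩
  have he : A.eval (u ++ v) = q := by
    rw [DFA.eval, DFA.evalFrom_of_append, hu', hv]
  have := h.length_le_rank hm
  rw [he, List.length_append] at this
  have := List.length_pos_of_ne_nil hvne
  omega

theorem rank_le_rank [Finite σ] {p q : σ} (hpq : Le A p q) : rank A p ≤ rank A q := by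
  by_cases e : p = q
  · rw [e]
  · exact (h.rank_lt_rank ⟨hpq, e⟩).le

/-- Rank is strictly increasing, so rank one more than that of `s` leaves no room for a state in
between. -/
theorem mem_separatorSet_iff [Finite σ] {s r : σ} (hs : IsSeparatorState A s) :
    r ∈ separatorSet A ↔ IsNext A s r := by
  constructor
  · rintro ⟨s', hs', hr⟩
    obtain rfl := h.separator_unique hs hs'
    have hsr : Lt A s r := h.separator_lt_of_not_le hs fun hle => by
      have := h.rank_le_rank hle
      omega
    refine ⟨hsr, ?_⟩
    rintro ⟨t, hst, htr⟩
    have := h.rank_lt_rank hst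
    have := h.rank_lt_rank htr
    omega
  · intro hr
    refine ⟨s, hs, ?_⟩
    have hlt := h.rank_lt_rank hr.1
    obtain ⟨w, hw, hm, hl⟩ := h.exists_length_eq_rank r
    rcases List.eq_nil_or_concat w with rfl | ⟨u, a, rfl⟩
    · simp at hl
      omega
    · rw [List.concat_eq_append] at hw hm hl
      obtain ⟨hum, ham, -⟩ := movesAlong_append.1 hm
      rw [DFA.eval_append_singleton] at hw
      have hlt' : Lt A (A.eval u) r := ⟨⟨[a], hw⟩, fun e => ham (hw.trans e.symm)⟩
      -- The last state before `r` on a longest path lies below `s`, so the path has length at most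
      -- `rank A s + 1`.
      have h₁ := h.rank_le_rank (h.le_separator_of_lt_of_isNext hs hr hlt')
      have h₂ := h.length_le_rank hum
      simp at hl
      omega

end IsReducedIdeal

end Separator

/-! ### Family automata -/

section Family

variable {α σ : Type} {A : DFA α σ}

namespace IsReducedIdeal

variable (h : IsReducedIdeal A)
include h

theorem comparable_of_mem_family [Finite σ] {s r x y : σ} (hs : IsSeparatorState A s)
    (hr : IsNext A s r) (hx : Le A x r) (hy : y ∈ family A r) : Le A x y ∨ Le A y x := by
  by_cases e : x = r
  · subst e
    exact hy.symm
  · exact h.comparable_of_le_separator hs (h.le_separator_of_lt_of_isNext hs hr ⟨hx, e⟩)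

/-- From `q` below `r`, the state `r` is a possible source, so a minimal source lies below `r`; it
is then comparable with the whole family, hence least. From `q` above `r`, the source is `q` itself.
-/
theorem exists_isFamilyAutomaton [Finite σ] {s r : σ} (hs : IsSeparatorState A s)
    (hr : IsNext A s r) : ∃ C, IsFamilyAutomaton A r C := by
  have key : ∀ (q : family A r) (a : α), ∃ s : σ,
      IsLeastState A {t | t ∈ family A r ∧ Le A q t ∧ A.step t a ∈ family A r} s := by
    rintro ⟨q, hq⟩ a
    by_cases hrq : Le A r q
    · exact ⟨q, ⟨hq, Le.refl A q, Or.inr (hrq.trans (le_step A q a))⟩, fun t ht => ht.2.1⟩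
    have hqr : Le A q r := hq.resolve_right hrq
    have hrm : r ∈ {t | t ∈ family A r ∧ Le A q t ∧ A.step t a ∈ family A r} :=
      ⟨Or.inl (Le.refl A r), hqr, Or.inr (le_step A r a)⟩
    obtain ⟨t, ht, hmin⟩ := h.exists_minimal _ ⟨r, hrm⟩
    have htr : Le A t r := by
      rcases ht.1 with htr | hrt
      · exact htr
      · exact hmin r hrm hrt ▸ Le.refl A r
    refine ⟨t, ht, fun x hx => ?_⟩
    rcases h.comparable_of_mem_family hs hr htr hx.1 with hle | hle
    · exact hle
    · exact hmin x hx hle ▸ Le.refl A x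
  choose f hf using key
  exact ⟨⟨fun q a => ⟨A.step (f q a) a, (hf q a).1.2.2⟩, ⟨A.start, Or.inl (h.reach r)⟩,
    {q | (q : σ) ∈ A.accept}⟩, rfl, fun q => Iff.rfl, fun q a => ⟨f q a, hf q a, rfl⟩⟩

variable {r : σ} {C : DFA α (family A r)} (hC : IsFamilyAutomaton A r C)
include hC

/-- The least source is `q` itself: the family automaton departs from `A` only where `A` leaves the
family. -/
theorem family_step_eq {q : family A r} {a : α} (hq : A.step q a ∈ family A r) :
    (C.step q a : σ) = A.step q a := by
  obtain ⟨s, hs, he⟩ := hC.2.2 q a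
  rw [he, h.antisymm (hs.2 q ⟨q.2, Le.refl A _, hq⟩) hs.1.2.1]

omit h in
theorem family_le_step (q : family A r) (a : α) : Le A (q : σ) (C.step q a : σ) := by
  obtain ⟨s, hs, he⟩ := hC.2.2 q a
  exact he ▸ hs.1.2.1.trans (le_step A s a)

theorem mem_family_acceptsFrom_iff {q : family A r} (hq : Le A r q) (w : List α) :
    w ∈ C.acceptsFrom q ↔ w ∈ A.acceptsFrom (q : σ) := by
  induction w generalizing q with
  | nil => exact hC.2.1 q
  | cons a w ih =>
    have hstep : Le A r (A.step q a) := hq.trans (le_step A _ a)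
    have he := h.family_step_eq hC (q := q) (Or.inr hstep)
    rw [cons_mem_acceptsFrom, cons_mem_acceptsFrom, ← he, ih (he ▸ hstep)]

theorem mem_family_acceptsFrom (w : List α) {q : family A r} (hw : w ∈ A.acceptsFrom (q : σ)) :
    w ∈ C.acceptsFrom q := by
  induction w generalizing q with
  | nil => exact (hC.2.1 q).2 hw
  | cons a w ih =>
    obtain ⟨s, hs, he⟩ := hC.2.2 q a
    refine ih ?_
    rw [he]
    exact h.mono _ _ hs.1.2.1 (a :: w) hw

theorem accepts_le_family (w : List α) (hw : w ∈ A.accepts) : w ∈ C.accepts := by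
  refine h.mem_family_acceptsFrom hC w ?_
  rw [hC.1]
  exact hw

theorem family_acceptsFrom_mono [Finite σ] {s : σ} (hs : IsSeparatorState A s)
    (hr : IsNext A s r) {x y : family A r} (hxy : Le A (x : σ) y) (w : List α) (hw : w ∈ C.acceptsFrom x) : w ∈ C.acceptsFrom y := by
  induction w generalizing x y with
  | nil => exact (hC.2.1 y).2 (h.accept_of_le hxy ((hC.2.1 x).1 hw))
  | cons a w ih =>
    obtain ⟨u, hu, hue⟩ := hC.2.2 x a
    obtain ⟨v, hv, hve⟩ := hC.2.2 y a
    have huv : Le A u v := hu.2 v ⟨hv.1.1, hxy.trans hv.1.2.1, hv.1.2.2⟩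
    rw [cons_mem_acceptsFrom] at hw ⊢
    have hmono : ∀ v ∈ A.acceptsFrom (C.step x a : σ), v ∈ A.acceptsFrom (C.step y a : σ) := by
      intro z hz
      rw [hue] at hz
      rw [hve]
      exact h.mono _ _ huv (a :: z) hz
    by_cases hle : Le A (C.step x a : σ) (C.step y a)
    · exact ih hle hw
    by_cases hrx : Le A r (C.step x a)
    · exact h.mem_family_acceptsFrom hC w (hmono w ((h.mem_family_acceptsFrom_iff hC hrx w).1 hw))
    have hxr := (C.step x a).2.resolve_right hrx
    have hyx : Le A (C.step y a : σ) (C.step x a) := by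
      rcases (C.step y a).2 with hyr | hry
      · exact (h.comparable_of_mem_family hs hr hyr (C.step x a).2).resolve_right hle
      · exact absurd (hxr.trans hry) hle
    -- The two targets are now in the reverse order, while the residuals in `A` are included the
    -- direct way: they coincide.
    have : C.step x a = C.step y a := Subtype.ext <| h.inj _ _ <|
      Set.ext fun v => ⟨hmono v, h.mono _ _ hyx v⟩
    exact this ▸ hw

theorem isIdeal_family [Finite σ] {s : σ} (hs : IsSeparatorState A s) (hr : IsNext A s r) :
    IsIdeal C.accepts :=
  isIdeal_accepts_of_step fun q a w hw =>
    h.family_acceptsFrom_mono hC hs hr (family_le_step hC q a) w hw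

omit hC in
-- Follow the run while it stays below `s`, where every family automaton copies it. Once it leaves,
-- choose an immediate successor of `s` below the state reached. If it never leaves, any successor
-- does, whence `hne`.
theorem exists_not_mem_family [Finite σ] {s : σ} (hs : IsSeparatorState A s)
    (hne : ∃ r, IsNext A s r) (w : List α) {q : σ} (hq : Le A q s) (hw : w ∉ A.acceptsFrom q) :
    ∃ r, IsNext A s r ∧ ∀ C, IsFamilyAutomaton A r C → ∀ q' : family A r, (q' : σ) = q →
      w ∉ C.acceptsFrom q' := by
  induction w generalizing q with
  | nil =>
    obtain ⟨r, hr⟩ := hne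
    refine ⟨r, hr, fun C hC q' he hw' => hw ?_⟩
    exact he ▸ (hC.2.1 q').1 hw'
  | cons a w ih =>
    by_cases hs' : Le A (A.step q a) s
    · obtain ⟨r, hr, H⟩ := ih hs' hw
      refine ⟨r, hr, fun C hC q' he => H C hC (C.step q' a) ?_⟩
      subst he
      exact h.family_step_eq hC (Or.inl (hs'.trans hr.1.1))
    · obtain ⟨r, hr, hle⟩ := h.exists_isNext_le (h.separator_lt_of_not_le hs hs')
      refine ⟨r, hr, fun C hC q' he => ?_⟩
      subst he
      have he := h.family_step_eq hC (q := q') (a := a) (Or.inr hle)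
      rw [cons_mem_acceptsFrom, h.mem_family_acceptsFrom_iff hC (he ▸ hle), he]
      exact hw

omit hC in
theorem mem_accepts_iff_family [Finite σ] {s : σ} (hs : IsSeparatorState A s)
    (hne : ∃ r, IsNext A s r) (w : List α) :
    w ∈ A.accepts ↔ ∀ r, IsNext A s r → ∃ C, IsFamilyAutomaton A r C ∧ w ∈ C.accepts := by
  constructor
  · intro hw r hr
    obtain ⟨C, hC⟩ := h.exists_isFamilyAutomaton hs hr
    exact ⟨C, hC, h.accepts_le_family hC w hw⟩
  · intro H
    by_contra hw
    obtain ⟨r, hr, hn⟩ := h.exists_not_mem_family hs hne w (h.reach s) hw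
    obtain ⟨C, hC, hwC⟩ := H r hr
    exact hn C hC C.start hC.1 hwC

omit h hC in
-- Distinct immediate successors are incomparable, so `X` meets the family only in `r`, which is
-- counted twice.
theorem card_family_add_card_le {s r : σ} [Fintype σ] {X : Finset σ} (hX : ∀ x ∈ X, IsNext A s x)
    (hr : r ∈ X) : Nat.card (family A r) + X.card ≤ Fintype.card σ + 1 := by
  classical
  have hd : Disjoint (family A r).toFinset (X.erase r) := by
    rw [Finset.disjoint_left]
    intro x hx hxX
    rw [Finset.mem_erase] at hxX
    exact not_mem_family (hX r hr) (hX x hxX.2) hxX.1 (by simpa using hx)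
  have := Finset.card_le_univ ((family A r).toFinset ∪ X.erase r)
  rw [Finset.card_union_of_disjoint hd, Finset.card_erase_of_mem hr] at this
  have h₁ : (family A r).toFinset.card = Nat.card (family A r) := by
    rw [Set.toFinset_card, Nat.card_eq_fintype_card]
  have := Finset.card_pos.2 ⟨r, hr⟩
  omega

end IsReducedIdeal
end Family

/-! ### Linear automata -/

section LinearAutomata

variable {α σ : Type} {A : DFA α σ}

theorem exists_isReducedAutomaton (A : DFA α σ) {q r : σ} (hr : r ≠ q) :
    ∃ C, IsReducedAutomaton A q r C := by
  classical
  have hne : ∀ x : σ, (if x = q then r else x) ≠ q := fun x => by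
    split_ifs with hx
    exacts [hr, hx]
  refine ⟨⟨fun x a => ⟨_, hne (A.step x a)⟩, ⟨_, hne A.start⟩, {x | (x : σ) ∈ A.accept}⟩,
    ?_, fun x => Iff.rfl, fun x a => ?_⟩
  · by_cases hq : A.start = q <;> simp [hq]
  · by_cases hq : A.step x a = q <;> simp [hq]

namespace IsReducedIdeal

variable (h : IsReducedIdeal A)
include h

/-- In the opposite order the two residuals would include each other, so the two targets would be
equal. -/
theorem step_le_step (hlin : IsLinear A) {x y : σ} (hxy : Le A x y) (a : α) :
    Le A (A.step x a) (A.step y a) := by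
  rcases hlin.2 (A.step x a) (A.step y a) with hle | hle
  · exact hle
  · rw [h.inj _ _ (Set.ext fun w => ⟨h.mono _ _ hxy (a :: w), h.mono _ _ hle w⟩)]
    exact Le.refl A _

omit h in
theorem isNext_le_of_lt (hlin : IsLinear A) {q r x : σ} (hqr : IsNext A q r) (hx : Lt A q x) :
    Le A r x := by
  rcases hlin.2 r x with hle | hle
  · exact hle
  · by_cases e : x = r
    · exact e ▸ Le.refl A x
    · exact absurd ⟨x, hx, hle, e⟩ hqr.2

omit h in
theorem le_isNext_of_lt (hlin : IsLinear A) {q r x : σ} (hqr : IsNext A q r) (hx : Lt A x r) :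
    Le A x q := by
  rcases hlin.2 x q with hle | hle
  · exact hle
  · by_cases e : q = x
    · exact e ▸ Le.refl A q
    · exact absurd ⟨x, ⟨hle, e⟩, hx⟩ hqr.2

/-! ### Removing one state of a linear automaton. -/

section Reduced

variable {q r : σ} (hqr : IsNext A q r) {C : DFA α {x : σ // x ≠ q}}
  (hC : IsReducedAutomaton A q r C)
include hqr hC

omit h in
theorem le_reduced_start : Le A A.start (C.start : σ) := by
  rcases hC.1 with ⟨h₁, h₂⟩ | ⟨-, h₂⟩
  · rw [h₁, h₂]
    exact hqr.1.1
  · rw [h₂]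
    exact Le.refl A _

omit h in
theorem step_le_reduced_step (x : {x : σ // x ≠ q}) (a : α) :
    Le A (A.step x a) (C.step x a : σ) := by
  rcases hC.2.2 x a with ⟨h₁, h₂⟩ | ⟨-, h₂⟩
  · rw [h₁, h₂]
    exact hqr.1.1
  · rw [h₂]
    exact Le.refl A _

theorem reduced_step_le_reduced_step (hlin : IsLinear A) {x y : {x : σ // x ≠ q}}
    (hxy : Le A (x : σ) y) (a : α) : Le A (C.step x a : σ) (C.step y a) := by
  have hstep := h.step_le_step hlin hxy a
  have hy := hstep.trans (step_le_reduced_step hqr hC y a)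
  rcases hC.2.2 x a with ⟨h₁, h₂⟩ | ⟨-, h₂⟩
  · rw [h₁] at hy
    rw [h₂]
    exact isNext_le_of_lt hlin hqr ⟨hy, fun e => (C.step y a).2 e.symm⟩
  · rw [h₂]
    exact hy

theorem reduced_acceptsFrom_mono (hlin : IsLinear A) {x y : {x : σ // x ≠ q}}
    (hxy : Le A (x : σ) y) (w : List α) (hw : w ∈ C.acceptsFrom x) : w ∈ C.acceptsFrom y := by
  induction w generalizing x y with
  | nil => exact (hC.2.1 y).2 (h.accept_of_le hxy ((hC.2.1 x).1 hw))
  | cons a w ih => exact ih (h.reduced_step_le_reduced_step hqr hC hlin hxy a) hw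

theorem isIdeal_reduced (hlin : IsLinear A) : IsIdeal C.accepts :=
  isIdeal_accepts_of_step fun x a w hw => h.reduced_acceptsFrom_mono hqr hC hlin
    ((le_step A x a).trans (step_le_reduced_step hqr hC x a)) w hw

theorem mem_reduced_acceptsFrom (hlin : IsLinear A) (w : List α) {x : σ} {y : {x : σ // x ≠ q}}
    (hxy : Le A x y) (hw : w ∈ A.acceptsFrom x) : w ∈ C.acceptsFrom y := by
  induction w generalizing x y with
  | nil => exact (hC.2.1 y).2 (h.accept_of_le hxy hw)
  | cons a w ih =>
    exact ih ((h.step_le_step hlin hxy a).trans (step_le_reduced_step hqr hC y a)) hw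

theorem accepts_le_reduced (hlin : IsLinear A) (w : List α) (hw : w ∈ A.accepts) :
    w ∈ C.accepts :=
  h.mem_reduced_acceptsFrom hqr hC hlin w (le_reduced_start hqr hC) hw

omit hqr in
-- A run starting strictly above `q` never meets `q`, so no transition of it is redirected.
theorem mem_reduced_acceptsFrom_iff (w : List α) {x : {x : σ // x ≠ q}} (hx : Lt A q x) :
    w ∈ C.acceptsFrom x ↔ w ∈ A.acceptsFrom (x : σ) := by
  induction w generalizing x with
  | nil => exact hC.2.1 x
  | cons a w ih =>
    have hlt := h.lt_of_lt_of_le hx (le_step A x a)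
    rcases hC.2.2 x a with ⟨h₁, -⟩ | ⟨-, h₂⟩
    · exact absurd h₁.symm hlt.2
    · rw [cons_mem_acceptsFrom, cons_mem_acceptsFrom, ← h₂, ih (h₂ ▸ hlt)]

end Reduced

/-! ### Recovering the language from the two reductions at a damping pattern. -/

section Damping

variable {p q r : σ} (hd : IsDampingPattern A p q r)
  {C₁ : DFA α {x : σ // x ≠ p}} (hC₁ : IsReducedAutomaton A p q C₁)
  {C₂ : DFA α {x : σ // x ≠ q}} (hC₂ : IsReducedAutomaton A q r C₂)
include hd hC₁ hC₂

/-- The three runs are at `p` in `A`, at `q` in `C₁`, at `p` in `C₂`. A letter fixing `p` changes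
nothing, by damping. A letter from `p` to `q` fixes `q`, so `C₁` and `A` meet there and agree
afterwards. Any other letter takes `A` and `C₂` to the same state beyond `q`. -/
theorem mem_acceptsFrom_of_damping (hlin : IsLinear A) (w : List α) {y : {x : σ // x ≠ p}}
    {z : {x : σ // x ≠ q}} (hy : (y : σ) = q) (hz : (z : σ) = p) (h₁ : w ∈ C₁.acceptsFrom y)
    (h₂ : w ∈ C₂.acceptsFrom z) : w ∈ A.acceptsFrom p := by
  have hpq := hd.1.1
  induction w generalizing y z with
  | nil => exact hz ▸ (hC₂.2.1 z).1 h₂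
  | cons a w ih =>
    have hs₁ := hC₁.2.2 y a
    have hs₂ := hC₂.2.2 z a
    rw [hy] at hs₁
    rw [hz] at hs₂
    rw [cons_mem_acceptsFrom] at h₁ h₂ ⊢
    by_cases hp : A.step p a = p
    · have hq := hd.2.2 a (Or.inl hp)
      rw [hp]
      refine ih ?_ ?_ h₁ h₂
      · rw [hq] at hs₁
        exact (hs₁.resolve_left fun e => hpq.2 e.1.symm).2
      · rw [hp] at hs₂
        exact (hs₂.resolve_left fun e => hpq.2 e.1).2
    by_cases hq : A.step p a = q
    · have hqq := hd.2.2 a (Or.inr hq)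
      rw [hqq] at hs₁
      have he := (hs₁.resolve_left fun e => hpq.2 e.1.symm).2
      rw [hq, ← he]
      exact (h.mem_reduced_acceptsFrom_iff hC₁ w (he ▸ hpq)).1 h₁
    · have he := (hs₂.resolve_left fun e => hq e.1).2
      rw [← he]
      refine (h.mem_reduced_acceptsFrom_iff hC₂ w ?_).1 h₂
      rw [he]
      exact ⟨isNext_le_of_lt hlin hd.1 ⟨le_step A p a, Ne.symm hp⟩, Ne.symm hq⟩

/-- Before `p` the three runs coincide; at `p` the damping argument takes over; strictly after `p`,
`C₁` behaves as `A`. -/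
theorem mem_acceptsFrom_of_reduced (hlin : IsLinear A) (w : List α) {x : σ}
    {y : {x : σ // x ≠ p}} {z : {x : σ // x ≠ q}}
    (hy : (x = p ∧ (y : σ) = q) ∨ (x ≠ p ∧ (y : σ) = x))
    (hz : (x = q ∧ (z : σ) = r) ∨ (x ≠ q ∧ (z : σ) = x))
    (h₁ : w ∈ C₁.acceptsFrom y) (h₂ : w ∈ C₂.acceptsFrom z) : w ∈ A.acceptsFrom x := by
  induction w generalizing x y z with
  | nil =>
    rcases hy with ⟨rfl, hy⟩ | ⟨-, rfl⟩
    · rcases hz with ⟨rfl, -⟩ | ⟨-, hz⟩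
      · exact absurd rfl hd.1.1.2
      · exact hz ▸ (hC₂.2.1 z).1 h₂
    · exact (hC₁.2.1 y).1 h₁
  | cons a w ih =>
    rcases hy with ⟨rfl, hy⟩ | ⟨hp, rfl⟩
    · rcases hz with ⟨rfl, -⟩ | ⟨-, hz⟩
      · exact absurd rfl hd.1.1.2
      · exact h.mem_acceptsFrom_of_damping hd hC₁ hC₂ hlin (a :: w) hy hz h₁ h₂
    · by_cases hpy : Le A p y
      · exact (h.mem_reduced_acceptsFrom_iff hC₁ (a :: w) ⟨hpy, Ne.symm hp⟩).1 h₁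
      · rcases hz with ⟨e, -⟩ | ⟨-, hz⟩
        · exact absurd (e ▸ hd.1.1.1) hpy
        · have hs₂ := hC₂.2.2 z a
          rw [hz] at hs₂
          exact ih (hC₁.2.2 y a) hs₂ h₁ h₂

theorem mem_accepts_iff_reduced (hlin : IsLinear A) (w : List α) :
    w ∈ A.accepts ↔ w ∈ C₁.accepts ∧ w ∈ C₂.accepts :=
  ⟨fun hw => ⟨h.accepts_le_reduced hd.1 hC₁ hlin w hw, h.accepts_le_reduced hd.2.1 hC₂ hlin w hw⟩,
    fun hw => h.mem_acceptsFrom_of_reduced hd hC₁ hC₂ hlin w hC₁.1 hC₂.1 hw.1 hw.2⟩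

end Damping

/-! ### Linear automata without damping pattern are prime -/

section Prime

variable [Finite σ]

omit h [Finite σ] in
-- Otherwise each `x` has a state `f x` of `B` covering its residual but that of no later state.
-- Then `f` is injective, since any two states of `A` are comparable.
theorem exists_level_of_card_lt {τ : Type} [Finite τ] (hlin : IsLinear A) (B : DFA α τ)
    (hcard : Nat.card τ < Nat.card σ) :
    ∃ x, ∀ p, (∀ w ∈ A.acceptsFrom x, w ∈ B.acceptsFrom p) →
      ∃ y, Lt A x y ∧ ∀ w ∈ A.acceptsFrom y, w ∈ B.acceptsFrom p := by
  by_contra! H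
  choose f hf hf' using H
  refine hcard.not_ge (Nat.card_le_card_of_injective f fun x y hxy => ?_)
  by_contra hne
  rcases hlin.2 x y with hle | hle
  · obtain ⟨w, hw, hn⟩ := hf' x y ⟨hle, hne⟩
    exact hn (hxy ▸ hf y w hw)
  · obtain ⟨w, hw, hn⟩ := hf' y x ⟨hle, Ne.symm hne⟩
    exact hn (hxy ▸ hf x w hw)

/-- Invariant of the climb: at `y`, the state of `B` covers the residual of a state strictly after
`y`. It is created when `y` is the missing level `x`, and carried from one state to the next by the
absence of damping. The word depends neither on `B` nor on `x`; the bound `t` only ensures that `y`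
has a successor. -/
theorem exists_word_of_no_damping (hlin : IsLinear A)
    (hd : ¬ ∃ p q r, IsDampingPattern A p q r) {t : σ} (y : σ) (hy : Lt A y t) :
    ∃ w, A.eval w = y ∧ ∀ (τ : Type) (B : DFA α τ), (∀ w ∈ A.accepts, w ∈ B.accepts) →
      ∀ x, Le A x y → (∀ p, (∀ w ∈ A.acceptsFrom x, w ∈ B.acceptsFrom p) →
        ∃ y, Lt A x y ∧ ∀ w ∈ A.acceptsFrom y, w ∈ B.acceptsFrom p) →
      ∃ z, Lt A y z ∧ ∀ v ∈ A.acceptsFrom z, v ∈ B.acceptsFrom (B.eval w) := by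
  let := h.partialOrder
  have hwf : WellFounded (Lt A) := (wellFounded_lt : WellFounded (α := σ) (· < ·))
  induction y using hwf.induction with
  | _ y ih =>
  have hself : ∀ (τ : Type) (B : DFA α τ), (∀ w ∈ A.accepts, w ∈ B.accepts) → ∀ u,
      ∀ w ∈ A.acceptsFrom (A.eval u), w ∈ B.acceptsFrom (B.eval u) := by
    intro τ B hAB u w hw
    exact append_mem_acceptsFrom.1 (hAB (u ++ w) (append_mem_acceptsFrom.2 hw))
  by_cases hstart : A.start = y
  · refine ⟨[], hstart, fun τ B hAB x hx hlevel => ?_⟩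
    obtain rfl : x = y := h.antisymm hx (hstart ▸ h.reach x)
    exact hlevel _ (hstart ▸ hself τ B hAB [])
  obtain ⟨p, -, hp⟩ := h.exists_le_isNext ⟨h.reach y, hstart⟩
  obtain ⟨r, hr, -⟩ := h.exists_isNext_le hy
  obtain ⟨u, hu, H⟩ := ih p hp.1 (h.lt_of_lt_of_le hp.1 hy.1)
  obtain ⟨v, hv, hvy⟩ : ∃ v, A.evalFrom p v = y ∧ A.evalFrom y v ≠ y := by
    -- The failure of damping yields a letter `a` not fixing `y`. If `a` fixes `p`, a letter `b`
    -- from `p` to `y` is appended; reading `ab` from `y` cannot return to `y`, by antisymmetry.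
    obtain ⟨a, ha, hay⟩ : ∃ a, (A.step p a = p ∨ A.step p a = y) ∧ A.step y a ≠ y := by
      by_contra! hno
      exact hd ⟨p, y, r, hp, hr, hno⟩
    rcases ha with ha | ha
    · obtain ⟨b, hb⟩ := IsReducedIdeal.exists_step_of_isNext hp
      refine ⟨[a, b], by simp [DFA.evalFrom_cons, ha, hb], fun e => hay (h.antisymm ?_ ?_)⟩
      · exact ⟨[b], e⟩
      · exact le_step A y a
    · exact ⟨[a], ha, hay⟩
  have huv : A.eval (u ++ v) = y := by
    rw [DFA.eval, DFA.evalFrom_of_append]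
    exact hv ▸ congrArg (A.evalFrom · v) hu
  refine ⟨u ++ v, huv, fun τ B hAB x hx hlevel => ?_⟩
  by_cases hxy : x = y
  · subst hxy
    exact hlevel _ (huv ▸ hself τ B hAB (u ++ v))
  · obtain ⟨z, hz, hzB⟩ := H τ B hAB x (le_isNext_of_lt hlin hp ⟨hx, hxy⟩) hlevel
    refine ⟨A.evalFrom y v, ⟨⟨v, rfl⟩, Ne.symm hvy⟩, fun w hw => ?_⟩
    rw [DFA.eval, DFA.evalFrom_of_append]
    -- A state strictly after `p` is at or after `y`, so `B` covers the residual of `y` before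
    -- reading `v`, hence that of `A.evalFrom y v` after it.
    refine append_mem_acceptsFrom.1 (hzB _ (h.mono _ _ (isNext_le_of_lt hlin hp hz) _ ?_))
    exact append_mem_acceptsFrom.2 hw

theorem exists_word_of_all_smaller (hlin : IsLinear A)
    (hd : ¬ ∃ p q r, IsDampingPattern A p q r) (hcard : 1 < Nat.card σ) :
    ∃ w, w ∉ A.accepts ∧ ∀ (τ : Type) [Finite τ] (B : DFA α τ),
      (∀ w ∈ A.accepts, w ∈ B.accepts) → Nat.card τ < Nat.card σ → w ∈ B.accepts := by
  obtain ⟨t, -, ht⟩ := h.exists_maximal Set.univ ⟨A.start, trivial⟩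
  have htop : ∀ x, Le A x t := fun x => (hlin.2 x t).elim id fun hle =>
    ht x trivial hle ▸ Le.refl A x
  have := Finite.one_lt_card_iff_nontrivial.1 hcard
  obtain ⟨x, hx⟩ := exists_ne t
  obtain ⟨y, -, hy⟩ := h.exists_le_isNext ⟨htop x, hx⟩
  obtain ⟨w, hw, H⟩ := h.exists_word_of_no_damping hlin hd y hy.1
  -- An accepting `y` would accept every word, just like the last state `t`, against distinctness of
  -- residuals.
  have hyn : y ∉ A.accept := fun hya => hy.1.2 <| h.inj _ _ <| Set.ext fun v =>
    ⟨h.mono _ _ hy.1.1 v, fun _ => h.accept_of_le ⟨v, rfl⟩ hya⟩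
  have hta : t ∈ A.accept := by
    by_contra hta
    refine hy.1.2 <| h.inj _ _ <| Set.ext fun v => ⟨h.mono _ _ hy.1.1 v, fun hv => ?_⟩
    exact absurd (h.accept_of_le (htop _) hv) hta
  refine ⟨w, fun hwA => hyn (hw ▸ hwA), fun τ _ B hAB hB => ?_⟩
  obtain ⟨x, hx⟩ := exists_level_of_card_lt hlin B hB
  -- The missing level is not the last one, since no state comes after `t`.
  have hxt : x ≠ t := by
    intro e
    rw [e] at hx
    obtain ⟨u, hu⟩ := h.reach t
    obtain ⟨z, hz, -⟩ := hx (B.eval u) fun v hv =>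
      append_mem_acceptsFrom.1 (hAB (u ++ v) (append_mem_acceptsFrom.2 (hu.symm ▸ hv)))
    exact hz.2 (ht z trivial hz.1).symm
  obtain ⟨z, hz, hzB⟩ := H τ B hAB x (le_isNext_of_lt hlin hy ⟨htop x, hxt⟩) hx
  exact hzB [] (h.accept_of_le (isNext_le_of_lt hlin hy hz) hta)

end Prime

end IsReducedIdeal

end LinearAutomata

/-! ### Minimal automata -/

section Minimal

variable {α σ : Type}

/-- A deterministic automaton with finitely many states, its states renamed. -/
noncomputable def FinAut.ofDFA (M : DFA α σ) [Fintype σ] : FinAut α where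
  size := Fintype.card σ
  step := (DFA.reindex (Fintype.equivFin σ) M).step
  start := (DFA.reindex (Fintype.equivFin σ) M).start
  accept := (DFA.reindex (Fintype.equivFin σ) M).accept.toFinite.toFinset

theorem FinAut.language_ofDFA (M : DFA α σ) [Fintype σ] : (FinAut.ofDFA M).language = M.accepts := by
  rw [← DFA.accepts_reindex M (Fintype.equivFin σ)]
  exact Set.ext fun w => Set.Finite.mem_toFinset (Set.toFinite _)

theorem FinAut.exists_isMinimal (L : Language α) (h : ∃ A : FinAut α, A.language = L) :
    ∃ B : FinAut α, B.IsMinimal ∧ B.language = L := by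
  classical
  have hex : ∃ n, ∃ A : FinAut α, A.language = L ∧ A.size = n := h.imp' _ fun A hA => ⟨A, hA, rfl⟩
  obtain ⟨B, hB, hn⟩ := Nat.find_spec hex
  exact ⟨B, fun A hA => hn ▸ Nat.find_min' hex ⟨A, hA.trans hB, rfl⟩, hB⟩

theorem FinAut.IsMinimal.size_le {B : FinAut α} (hB : B.IsMinimal) [Finite σ] {M : DFA α σ}
    (h : B.language = M.accepts) : B.size ≤ Nat.card σ := by
  have := Fintype.ofFinite σ
  rw [Nat.card_eq_fintype_card]
  exact hB (FinAut.ofDFA M) ((FinAut.language_ofDFA M).trans h.symm)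

theorem FinAut.exists_isMinimal_of_dfa [Finite σ] (M : DFA α σ) :
    ∃ B : FinAut α, B.IsMinimal ∧ B.language = M.accepts := by
  have := Fintype.ofFinite σ
  exact FinAut.exists_isMinimal _ ⟨_, FinAut.language_ofDFA M⟩

/-- Myhill–Nerode: a word chosen for each residual of the language gives an injection of residuals
into states, bijective by minimality. Growth along transitions is the ideal property applied to an
inserted factor. -/
theorem FinAut.IsMinimal.isReducedIdeal {A : FinAut α} (hA : A.IsMinimal)
    (hI : IsIdeal A.language) : IsReducedIdeal A.toDFA := by
  have hfin : (Set.range A.language.leftQuotient).Finite :=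
    Language.IsRegular.finite_range_leftQuotient ⟨Fin A.size, inferInstance, A.toDFA, rfl⟩
  have := hfin.to_subtype
  have hcard : A.size ≤ Nat.card (Set.range A.language.leftQuotient) :=
    hA.size_le (M := A.language.toDFA) A.language.accepts_toDFA.symm
  have hres : ∀ u, A.language.leftQuotient u = A.toDFA.acceptsFrom (A.toDFA.eval u) :=
    fun u => Language.leftQuotient_accepts_apply A.toDFA u
  choose f hf using fun x : Set.range A.language.leftQuotient => x.2
  have hinj : Function.Injective fun x => A.toDFA.eval (f x) := fun x y hxy => Subtype.ext <| by
    rw [← hf x, ← hf y, hres, hres]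
    exact congrArg _ hxy
  have hbij := (Nat.bijective_iff_injective_and_card _).2 ⟨hinj,
    (Nat.card_le_card_of_injective _ hinj).antisymm (by simpa using hcard)⟩
  have hreach : ∀ q, Le A.toDFA A.toDFA.start q := fun q =>
    (hbij.2 q).imp' f fun x hx => hx
  refine ⟨hreach, fun q r hqr w hw => ?_, fun q r hqr => ?_⟩
  · obtain ⟨u, rfl⟩ := hreach q
    obtain ⟨v, rfl⟩ := hqr
    rw [← append_mem_acceptsFrom, ← append_mem_acceptsFrom]
    rw [← append_mem_acceptsFrom] at hw
    exact hI _ hw _ ((List.sublist_append_right v w).append_left u)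
  · obtain ⟨x, rfl⟩ := hbij.2 q
    obtain ⟨y, rfl⟩ := hbij.2 r
    refine congrArg (fun x => A.toDFA.eval (f x)) (Subtype.ext ?_)
    rw [← hf x, ← hf y, hres, hres]
    exact hqr

/-! ### Words bounded in length -/

theorem exists_length_lt_evalFrom_eq [Fintype σ] (M : DFA α σ) (s : σ) (w : List α) :
    ∃ v : List α, v.length < Fintype.card σ ∧ M.evalFrom s v = M.evalFrom s w := by
  induction hn : w.length using Nat.strong_induction_on generalizing w with
  | _ n ih =>
  subst hn
  by_cases hlt : w.length < Fintype.card σ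
  · exact ⟨w, hlt, rfl⟩
  · obtain ⟨q, a, b, c, rfl, -, hb, ha, hq, hc⟩ := M.evalFrom_split (not_lt.1 hlt) rfl
    have hlen : (a ++ c).length < (a ++ b ++ c).length := by
      have := List.length_pos_of_ne_nil hb
      simp
      omega
    obtain ⟨v, hvl, hve⟩ := ih _ hlen (a ++ c) rfl
    exact ⟨v, hvl, by rw [hve, M.evalFrom_of_append, ha, hc]⟩

/-- In the product automaton, each reachable pair of states is reached by a word shorter than the
number of pairs. -/
theorem accepts_eq_of_bounded {τ : Type} [Fintype σ] [Fintype τ] (M : DFA α σ) (N : DFA α τ)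
    (h : ∀ w : List α, w.length < Fintype.card σ * Fintype.card τ → (w ∈ M.accepts ↔ w ∈ N.accepts)) :
    M.accepts = N.accepts := by
  have hsplit : ∀ (w : List α) (s : σ) (t : τ),
      (M.inter N).evalFrom (s, t) w = (M.evalFrom s w, N.evalFrom t w) := by
    intro w
    induction w with
    | nil => exact fun _ _ => rfl
    | cons a w ih => exact fun s t => ih _ _
  refine Set.ext fun w => ?_
  obtain ⟨v, hvl, hve⟩ := exists_length_lt_evalFrom_eq (M.inter N) (M.start, N.start) w
  rw [hsplit, hsplit, Prod.mk.injEq] at hve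
  have := h v (by rwa [Fintype.card_prod] at hvl)
  rw [DFA.mem_accepts, DFA.mem_accepts, DFA.eval, DFA.eval, hve.1, hve.2] at this
  exact this

/-! ### Prime automata -/

theorem FinAut.isInterPrime_of_no_damping {A : FinAut α} (hA : A.IsMinimal)
    (hI : IsIdeal A.language) (hlin : IsLinear A.toDFA)
    (hd : ¬ ∃ p q r, IsDampingPattern A.toDFA p q r) : A.IsInterPrime := by
  refine ⟨hA, ?_⟩
  rintro ⟨D, hne, hlt, hD⟩
  obtain ⟨B, hB⟩ := List.exists_mem_of_ne_nil D hne
  -- Every automaton has a state, so one with a smaller companion has at least two.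
  have hpos : 0 < B.size := B.start.pos
  have hcard : 1 < Nat.card (Fin A.size) := by
    have := hlt B hB
    rw [Nat.card_fin]
    omega
  obtain ⟨w, hw, H⟩ := (hA.isReducedIdeal hI).exists_word_of_all_smaller hlin hd hcard
  refine hw ((hD w).2 fun B hB => H _ B.toDFA (fun v hv => (hD v).1 hv B hB) ?_)
  rw [Nat.card_fin, Nat.card_fin]
  exact hlt B hB

end Minimal
end IdealAutomata

-- Closure properties of primitive recursion become rules for `fun_prop`, so the functions below are
-- primitive recursive by the shape of their definitions.
attribute [fun_prop] Primrec
attribute [fun_prop] Primrec.id Primrec.const Primrec.comp Primrec.fst Primrec.snd Primrec.pair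

namespace IdealAutomata

/-! ### Compositional primitive recursion -/

section Primrec

variable {α β γ : Type} [Primcodable α] [Primcodable β] [Primcodable γ]

@[fun_prop]
theorem primrec_add {f g : α → ℕ} (hf : Primrec f) (hg : Primrec g) :
    Primrec fun a => f a + g a := Primrec.nat_add.comp hf hg

@[fun_prop]
theorem primrec_mul {f g : α → ℕ} (hf : Primrec f) (hg : Primrec g) :
    Primrec fun a => f a * g a := Primrec.nat_mul.comp hf hg

@[fun_prop]
theorem primrec_decide_le {f g : α → ℕ} (hf : Primrec f) (hg : Primrec g) :
    Primrec fun a => decide (f a ≤ g a) := Primrec.nat_le.decide.comp hf hg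

@[fun_prop]
theorem primrec_beq [DecidableEq β] {f g : α → β} (hf : Primrec f) (hg : Primrec g) :
    Primrec fun a => f a == g a := Primrec.beq.comp hf hg

@[fun_prop]
theorem primrec_not {f : α → Bool} (hf : Primrec f) : Primrec fun a => !f a := Primrec.not.comp hf

@[fun_prop]
theorem primrec_and {f g : α → Bool} (hf : Primrec f) (hg : Primrec g) :
    Primrec fun a => f a && g a := Primrec.and.comp hf hg

@[fun_prop]
theorem primrec_or {f g : α → Bool} (hf : Primrec f) (hg : Primrec g) :
    Primrec fun a => f a || g a := Primrec.or.comp hf hg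

@[fun_prop]
theorem primrec_cond {c : α → Bool} {f g : α → β} (hc : Primrec c) (hf : Primrec f)
    (hg : Primrec g) : Primrec fun a => bif c a then f a else g a := Primrec.cond hc hf hg

@[fun_prop]
theorem primrec_cons {f : α → β} {g : α → List β} (hf : Primrec f) (hg : Primrec g) :
    Primrec fun a => f a :: g a := Primrec.list_cons.comp hf hg

@[fun_prop]
theorem primrec_getD {f : α → List β} {g : α → ℕ} (d : β) (hf : Primrec f) (hg : Primrec g) :
    Primrec fun a => (f a).getD (g a) d := (Primrec.list_getD d).comp hf hg

@[fun_prop]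
theorem primrec_headI [Inhabited β] {f : α → List β} (hf : Primrec f) :
    Primrec fun a => (f a).headI := Primrec.list_headI.comp hf

@[fun_prop]
theorem primrec_range {f : α → ℕ} (hf : Primrec f) : Primrec fun a => List.range (f a) :=
  Primrec.list_range.comp hf

@[fun_prop]
theorem primrec_map {f : α → List β} {g : α → β → γ} (hf : Primrec f)
    (hg : Primrec fun x : α × β => g x.1 x.2) : Primrec fun a => (f a).map (g a) :=
  Primrec.list_map hf hg

@[fun_prop]
theorem primrec_flatMap {f : α → List β} {g : α → β → List γ} (hf : Primrec f)
    (hg : Primrec fun x : α × β => g x.1 x.2) : Primrec fun a => (f a).flatMap (g a) :=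
  Primrec.list_flatMap hf hg

@[fun_prop]
theorem primrec_foldl {f : α → List β} {g : α → γ} {h : α → γ → β → γ} (hf : Primrec f)
    (hg : Primrec g) (hh : Primrec fun x : α × γ × β => h x.1 x.2.1 x.2.2) :
    Primrec fun a => (f a).foldl (h a) (g a) :=
  Primrec.list_foldl (h := fun a y => h a y.1 y.2) hf hg hh

@[fun_prop]
theorem primrec_iterate {f : α → ℕ} {g : α → β} {h : α → β → β} (hf : Primrec f)
    (hg : Primrec g) (hh : Primrec fun x : α × β => h x.1 x.2) :
    Primrec fun a => (h a)^[f a] (g a) := Primrec.nat_iterate hf hg hh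

@[fun_prop]
theorem primrec_filter {f : α → List β} {p : α → β → Bool} (hf : Primrec f)
    (hp : Primrec fun x : α × β => p x.1 x.2) : Primrec fun a => (f a).filter (p a) := by
  have : Primrec fun a => (f a).flatMap fun b => bif p a b then [b] else [] := by fun_prop
  refine this.of_eq fun a => ?_
  induction f a with
  | nil => rfl
  | cons b l ih =>
    rw [List.flatMap_cons, ih, List.filter_cons]
    cases p a b <;> rfl

@[fun_prop]
theorem primrec_any {f : α → List β} {p : α → β → Bool} (hf : Primrec f)
    (hp : Primrec fun x : α × β => p x.1 x.2) : Primrec fun a => (f a).any (p a) := by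
  have : Primrec fun a => ((f a).map (p a)).foldl (fun x y => x || y) false := by fun_prop
  refine this.of_eq fun a => ?_
  suffices h : ∀ (l : List β) x, (l.map (p a)).foldl (fun x y => x || y) x = (x || l.any (p a)) by
    simpa using h (f a) false
  intro l
  induction l with
  | nil => simp
  | cons b l ih => simp [ih, Bool.or_assoc]

@[fun_prop]
theorem primrec_all {f : α → List β} {p : α → β → Bool} (hf : Primrec f)
    (hp : Primrec fun x : α × β => p x.1 x.2) : Primrec fun a => (f a).all (p a) := by
  have : Primrec fun a => !(f a).any fun b => !p a b := by fun_prop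
  exact this.of_eq fun a => by rw [Bool.eq_iff_iff]; simp

end Primrec

/-! ### Lists of bounded size -/

/-- The first element of a list satisfying a predicate. -/
def firstSat {β : Type} [Inhabited β] (l : List β) (p : β → Bool) : β := (l.filter p).headI

/-- The witness `x` rules out the empty list, on which `headI` is a default value. -/
theorem firstSat_spec {β : Type} [Inhabited β] {l : List β} {p : β → Bool} {x : β} (hx : x ∈ l)
    (hp : p x = true) : firstSat l p ∈ l ∧ p (firstSat l p) = true := by
  have hmem : x ∈ l.filter p := List.mem_filter.2 ⟨hx, hp⟩
  refine List.mem_filter.1 (?_ : (l.filter p).headI ∈ l.filter p)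
  cases hl : l.filter p with
  | nil => rw [hl] at hmem; exact absurd hmem (by simp)
  | cons y t => simp

/-- The lists of length `n` with entries in `l`. -/
def listsOfLength {β : Type} (l : List β) (n : ℕ) : List (List β) :=
  (fun L => l.flatMap fun x => L.map fun t => x :: t)^[n] [[]]

theorem mem_listsOfLength {β : Type} {l : List β} {n : ℕ} {t : List β} :
    t ∈ listsOfLength l n ↔ t.length = n ∧ ∀ x ∈ t, x ∈ l := by
  induction n generalizing t with
  | zero => simp +contextual [listsOfLength]
  | succ n ih =>
    rw [listsOfLength, Function.iterate_succ_apply', ← listsOfLength]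
    cases t with
    | nil => simp
    | cons x t =>
      simp only [List.mem_flatMap, List.mem_map, ih, List.length_cons, List.mem_cons,
        List.cons.injEq]
      constructor
      · rintro ⟨_, ha, _, ⟨hu, hul⟩, rfl, rfl⟩
        exact ⟨by rw [hu], by rintro y (rfl | hy); exacts [ha, hul y hy]⟩
      · rintro ⟨hl, hmem⟩
        exact ⟨x, hmem x (Or.inl rfl), t, ⟨by omega, fun y hy => hmem y (Or.inr hy)⟩, rfl, rfl⟩

/-- The words of length at most `n` over the alphabet `{0, …, k - 1}`. -/
def wordsUpTo (k n : ℕ) : List (List ℕ) :=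
  (List.range (n + 1)).flatMap fun i => listsOfLength (List.range k) i

theorem mem_wordsUpTo {k n : ℕ} {w : List ℕ} :
    w ∈ wordsUpTo k n ↔ w.length ≤ n ∧ ∀ a ∈ w, a < k := by
  simp [wordsUpTo, mem_listsOfLength]

section Primrec

variable {α β : Type} [Primcodable α] [Primcodable β]

@[fun_prop]
theorem primrec_firstSat [Inhabited β] {f : α → List β} {p : α → β → Bool} (hf : Primrec f)
    (hp : Primrec fun x : α × β => p x.1 x.2) : Primrec fun a => firstSat (f a) (p a) := by
  unfold firstSat
  fun_prop

@[fun_prop]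
theorem primrec_listsOfLength {f : α → List β} {g : α → ℕ} (hf : Primrec f) (hg : Primrec g) :
    Primrec fun a => listsOfLength (f a) (g a) := by
  unfold listsOfLength
  fun_prop

@[fun_prop]
theorem primrec_wordsUpTo {f g : α → ℕ} (hf : Primrec f) (hg : Primrec g) :
    Primrec fun a => wordsUpTo (f a) (g a) := by
  unfold wordsUpTo
  fun_prop

end Primrec

/-! ### The procedure on descriptions of automata -/

namespace Code

def letters (c : Code) : ℕ := c.1

def size (c : Code) : ℕ := c.2.1

def start (c : Code) : ℕ := c.2.2.1

/-- The defaults here and in `step` are never reached from a valid state and letter of the code of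
an automaton. -/
def accepting (c : Code) (q : ℕ) : Bool := c.2.2.2.1.getD q false

def step (c : Code) (q a : ℕ) : ℕ := (c.2.2.2.2.getD q []).getD a 0

def states (c : Code) : List ℕ := List.range c.size

def run (c : Code) (q : ℕ) (w : List ℕ) : ℕ := w.foldl (fun q a => c.step q a) q

/-- Longer words are not needed: loops of a run can be cut out. -/
def le (c : Code) (q r : ℕ) : Bool :=
  (wordsUpTo c.letters c.size).any fun w => c.run q w == r

def lt (c : Code) (q r : ℕ) : Bool := c.le q r && !(q == r)

/-- Antisymmetry is not tested, as it holds in every minimal automaton of an ideal. -/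
def isLinear (c : Code) : Bool :=
  c.states.all fun q => c.states.all fun r => c.le q r || c.le r q

def isNext (c : Code) (q r : ℕ) : Bool :=
  c.lt q r && !c.states.any fun s => c.lt q s && c.lt s r

def isDamping (c : Code) (t : ℕ × ℕ × ℕ) : Bool :=
  c.isNext t.1 t.2.1 && c.isNext t.2.1 t.2.2 &&
    (List.range c.letters).all fun a =>
      !(c.step t.1 a == t.1 || c.step t.1 a == t.2.1) || c.step t.2.1 a == t.2.1

def triples (c : Code) : List (ℕ × ℕ × ℕ) :=
  c.states.flatMap fun p => c.states.flatMap fun q => c.states.map fun r => (p, q, r)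

def isBranching (c : Code) (q : ℕ) : Bool :=
  !c.states.any fun m => c.lt q m && c.states.all fun x => !c.lt q x || c.le m x

def isSeparator (c : Code) (s : ℕ) : Bool :=
  c.isBranching s && c.states.all fun x => !c.isBranching x || c.le s x

/-- Whether `r` belongs to the separator set. -/
def isNextSeparator (c : Code) (r : ℕ) : Bool :=
  c.states.any fun s => c.isSeparator s && c.isNext s r

def inFamily (c : Code) (r q : ℕ) : Bool := c.le q r || c.le r q

/-- Whether `s` may be the source of the transition of the family automaton at `r` by `a` from `q`,
but for minimality. -/
def familySource (c : Code) (r q a s : ℕ) : Bool :=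
  c.inFamily r s && (c.le q s && c.inFamily r (c.step s a))

def isLeastSource (c : Code) (r q a s : ℕ) : Bool :=
  c.familySource r q a s && c.states.all fun t => !c.familySource r q a t || c.le s t

def familyStep (c : Code) (r q a : ℕ) : ℕ :=
  c.step (firstSat c.states fun s => c.isLeastSource r q a s) a

def familyAccepts (c : Code) (r : ℕ) (w : List ℕ) : Bool :=
  c.accepting (w.foldl (fun q a => c.familyStep r q a) c.start)

/-- `r` in place of `q`, and the other states unchanged. -/
def redirect (q r x : ℕ) : ℕ := bif x == q then r else x

def reducedAccepts (c : Code) (q r : ℕ) (w : List ℕ) : Bool :=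
  c.accepting (w.foldl (fun x a => redirect q r (c.step x a)) (redirect q r c.start))

/-- The descriptions of the automata with at most `n` states over `k` letters. -/
def candidates (k n : ℕ) : List Code :=
  (List.range (n + 1)).flatMap fun m => (List.range m).flatMap fun i =>
    (listsOfLength [true, false] m).flatMap fun F =>
      (listsOfLength (listsOfLength (List.range m) k) m).map fun T => (k, m, i, F, T)

/-- `B` accepts or rejects the words of `T` as the table `T` says. -/
def agrees (B : Code) (T : List (List ℕ × Bool)) : Bool :=
  T.all fun x => B.accepting (B.run B.start x.1) == x.2

def isSmallest (k n : ℕ) (T : List (List ℕ × Bool)) (B : Code) : Bool :=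
  B.agrees T && (candidates k n).all fun B' => !B'.agrees T || decide (B.size ≤ B'.size)

/-- A smallest automaton, with at most `n` states over `k` letters, agreeing with the table `T`. -/
def smallest (k n : ℕ) (T : List (List ℕ × Bool)) : Code :=
  firstSat (candidates k n) fun B => isSmallest k n T B

/-- Enough words to tell apart two automata with at most as many states as `c`. -/
def testWords (c : Code) : List (List ℕ) := wordsUpTo c.letters (c.size * c.size)

/-- The family automaton is never written down: its runs are simulated on the states of `c`, and
only its acceptance table is passed to the search. -/
def minimizedFamily (c : Code) (r : ℕ) : Code :=
  smallest c.letters c.size (c.testWords.map fun w => (w, c.familyAccepts r w))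

def minimizedReduced (c : Code) (q r : ℕ) : Code :=
  smallest c.letters c.size (c.testWords.map fun w => (w, c.reducedAccepts q r w))

/-- One round of the procedure. -/
def decompose (c : Code) : List Code :=
  bif c.isLinear then
    bif c.triples.any fun t => c.isDamping t then
      [c.minimizedReduced (firstSat c.triples fun t => c.isDamping t).1
        (firstSat c.triples fun t => c.isDamping t).2.1,
       c.minimizedReduced (firstSat c.triples fun t => c.isDamping t).2.1
        (firstSat c.triples fun t => c.isDamping t).2.2]
    else [c]
  else (c.states.filter fun r => c.isNextSeparator r).map fun r => c.minimizedFamily r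

/-- `n` rounds of the procedure. -/
def iterateDecompose (n : ℕ) (c : Code) : List Code :=
  (fun D => D.flatMap fun c => c.decompose)^[n] [c]

/-! ### The procedure is primitive recursive -/

section Primrec

variable {α : Type} [Primcodable α] {c : α → Code} (hc : Primrec c) {f g h i : α → ℕ}
  (hf : Primrec f) (hg : Primrec g)

include hc

@[fun_prop]
theorem primrec_letters : Primrec fun x => (c x).letters := by unfold letters; fun_prop

@[fun_prop]
theorem primrec_size : Primrec fun x => (c x).size := by unfold size; fun_prop

@[fun_prop]
theorem primrec_start : Primrec fun x => (c x).start := by unfold start; fun_prop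

@[fun_prop]
theorem primrec_states : Primrec fun x => (c x).states := by unfold states; fun_prop

@[fun_prop]
theorem primrec_testWords : Primrec fun x => (c x).testWords := by unfold testWords; fun_prop

@[fun_prop]
theorem primrec_triples : Primrec fun x => (c x).triples := by unfold triples; fun_prop

include hf

@[fun_prop]
theorem primrec_accepting : Primrec fun x => (c x).accepting (f x) := by
  unfold accepting; fun_prop

@[fun_prop]
theorem primrec_run {w : α → List ℕ} (hw : Primrec w) :
    Primrec fun x => (c x).run (f x) (w x) := by unfold run step; fun_prop

include hg

@[fun_prop]
theorem primrec_step : Primrec fun x => (c x).step (f x) (g x) := by unfold step; fun_prop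

@[fun_prop]
theorem primrec_le : Primrec fun x => (c x).le (f x) (g x) := by unfold le; fun_prop

@[fun_prop]
theorem primrec_lt : Primrec fun x => (c x).lt (f x) (g x) := by unfold lt; fun_prop

@[fun_prop]
theorem primrec_isNext : Primrec fun x => (c x).isNext (f x) (g x) := by unfold isNext; fun_prop

@[fun_prop]
theorem primrec_inFamily : Primrec fun x => (c x).inFamily (f x) (g x) := by
  unfold inFamily; fun_prop

omit hc in
@[fun_prop]
theorem primrec_redirect (hh : Primrec h) : Primrec fun x => redirect (f x) (g x) (h x) := by
  unfold redirect; fun_prop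

@[fun_prop]
theorem primrec_reducedAccepts {w : α → List ℕ} (hw : Primrec w) :
    Primrec fun x => (c x).reducedAccepts (f x) (g x) (w x) := by
  unfold reducedAccepts; fun_prop

@[fun_prop]
theorem primrec_familySource (hh : Primrec h) (hi : Primrec i) :
    Primrec fun x => (c x).familySource (f x) (g x) (h x) (i x) := by
  unfold familySource; fun_prop

@[fun_prop]
theorem primrec_familyStep (hh : Primrec h) :
    Primrec fun x => (c x).familyStep (f x) (g x) (h x) := by
  unfold familyStep isLeastSource; fun_prop

omit hg

@[fun_prop]
theorem primrec_familyAccepts {w : α → List ℕ} (hw : Primrec w) :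
    Primrec fun x => (c x).familyAccepts (f x) (w x) := by
  unfold familyAccepts; fun_prop

@[fun_prop]
theorem primrec_isBranching : Primrec fun x => (c x).isBranching (f x) := by
  unfold isBranching; fun_prop

@[fun_prop]
theorem primrec_isSeparator : Primrec fun x => (c x).isSeparator (f x) := by
  unfold isSeparator; fun_prop

@[fun_prop]
theorem primrec_isNextSeparator : Primrec fun x => (c x).isNextSeparator (f x) := by
  unfold isNextSeparator; fun_prop

omit hf

@[fun_prop]
theorem primrec_isLinear : Primrec fun x => (c x).isLinear := by unfold isLinear; fun_prop

@[fun_prop]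
theorem primrec_isDamping {t : α → ℕ × ℕ × ℕ} (ht : Primrec t) :
    Primrec fun x => (c x).isDamping (t x) := by unfold isDamping; fun_prop

@[fun_prop]
theorem primrec_agrees {T : α → List (List ℕ × Bool)} (hT : Primrec T) :
    Primrec fun x => agrees (c x) (T x) := by unfold agrees; fun_prop

omit hc

include hf hg

@[fun_prop]
theorem primrec_candidates : Primrec fun x => candidates (f x) (g x) := by
  unfold candidates; fun_prop

@[fun_prop]
theorem primrec_smallest {T : α → List (List ℕ × Bool)} (hT : Primrec T) :
    Primrec fun x => smallest (f x) (g x) (T x) := by unfold smallest isSmallest; fun_prop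

include hc

@[fun_prop]
theorem primrec_minimizedReduced : Primrec fun x => (c x).minimizedReduced (f x) (g x) := by
  unfold minimizedReduced; fun_prop

omit hg

@[fun_prop]
theorem primrec_minimizedFamily : Primrec fun x => (c x).minimizedFamily (f x) := by
  unfold minimizedFamily; fun_prop

omit hf

@[fun_prop]
theorem primrec_decompose : Primrec fun x => (c x).decompose := by
  unfold decompose; fun_prop

include hf

theorem primrec_iterateDecompose : Primrec fun x => (c x).iterateDecompose (f x) := by
  unfold iterateDecompose; fun_prop

end Primrec
end Code

/-! ### Correctness of the procedure on descriptions -/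

theorem not_or_eq_true_iff {a b : Bool} : (!a || b) = true ↔ (a = true → b = true) := by
  cases a <;> simp

namespace FinAut

variable {k : ℕ} (A : FinAut (Fin k))

@[simp] theorem letters_code : A.code.letters = k := rfl

@[simp] theorem size_code : A.code.size = A.size := rfl

@[simp] theorem start_code : A.code.start = (A.toDFA.start : ℕ) := rfl

@[simp] theorem accepting_code (q : Fin A.size) :
    A.code.accepting q = true ↔ q ∈ A.toDFA.accept := by
  simp [Code.accepting, code, toDFA]

@[simp] theorem step_code (q : Fin A.size) (a : Fin k) :
    A.code.step q a = (A.toDFA.step q a : ℕ) := by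
  simp [Code.step, code, toDFA]

@[simp] theorem run_code (q : Fin A.size) (w : List (Fin k)) :
    A.code.run q (w.map Fin.val) = (A.toDFA.evalFrom q w : ℕ) := by
  induction w generalizing q with
  | nil => rfl
  | cons a w ih => rw [DFA.evalFrom_cons, ← ih, ← step_code]; rfl

theorem all_states_code {p : ℕ → Bool} :
    A.code.states.all p = true ↔ ∀ q : Fin A.size, p q = true := by
  simp [Code.states, Fin.forall_iff]

theorem any_states_code {p : ℕ → Bool} :
    A.code.states.any p = true ↔ ∃ q : Fin A.size, p q = true := by
  simp [Code.states, Fin.exists_iff]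

end FinAut

theorem exists_map_val_eq {k : ℕ} {w : List ℕ} (hw : ∀ a ∈ w, a < k) :
    ∃ v : List (Fin k), v.map Fin.val = w := by
  lift w to List (Fin k) using hw
  exact ⟨w, rfl⟩

theorem map_val_mem_wordsUpTo {k n : ℕ} {w : List (Fin k)} :
    w.map Fin.val ∈ wordsUpTo k n ↔ w.length ≤ n := by
  simp [mem_wordsUpTo]

namespace FinAut

variable {k : ℕ} (A : FinAut (Fin k))

@[simp] theorem le_code (q r : Fin A.size) : A.code.le q r = true ↔ Le A.toDFA q r := by
  simp only [Code.le, List.any_eq_true, beq_iff_eq, letters_code, size_code]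
  constructor
  · rintro ⟨w, hw, hr⟩
    obtain ⟨v, rfl⟩ := exists_map_val_eq (mem_wordsUpTo.1 hw).2
    rw [run_code] at hr
    exact ⟨v, Fin.ext hr⟩
  · rintro ⟨w, hw⟩
    obtain ⟨v, hvl, hv⟩ := exists_length_lt_evalFrom_eq A.toDFA q w
    rw [Fintype.card_fin] at hvl
    exact ⟨v.map Fin.val, map_val_mem_wordsUpTo.2 hvl.le, by rw [run_code, hv, hw]⟩

@[simp] theorem lt_code (q r : Fin A.size) : A.code.lt q r = true ↔ Lt A.toDFA q r := by
  simp [Code.lt, Lt, Fin.val_inj]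

@[simp] theorem isNext_code (q r : Fin A.size) :
    A.code.isNext q r = true ↔ IsNext A.toDFA q r := by
  rw [Code.isNext, Bool.and_eq_true, Bool.not_eq_true', ← Bool.not_eq_true, any_states_code]
  simp [IsNext]

theorem isLinear_code (h : IsReducedIdeal A.toDFA) :
    A.code.isLinear = true ↔ IsLinear A.toDFA := by
  simp only [Code.isLinear, all_states_code, Bool.or_eq_true, le_code]
  exact ⟨fun H => ⟨fun q r => h.antisymm, H⟩, fun H => H.2⟩

theorem isDamping_code (p q r : Fin A.size) :
    A.code.isDamping (p, q, r) = true ↔ IsDampingPattern A.toDFA p q r := by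
  simp only [Code.isDamping, Bool.and_eq_true, isNext_code, IsDampingPattern, and_assoc,
    letters_code, List.all_eq_true, List.mem_range, Bool.or_eq_true, Bool.not_eq_true',
    Bool.or_eq_false_iff, beq_eq_false_iff_ne, beq_iff_eq]
  refine and_congr_right fun _ => and_congr_right fun _ => ⟨fun H a ha => ?_, fun H a ha => ?_⟩
  · have := H a a.2
    simp only [step_code, ne_eq, Fin.val_inj] at this
    tauto
  · have := H ⟨a, ha⟩
    have hs := fun q => A.step_code q ⟨a, ha⟩
    simp only at hs
    simp only [hs, ne_eq, Fin.val_inj]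
    tauto

theorem mem_triples_code {t : ℕ × ℕ × ℕ} :
    t ∈ A.code.triples ↔ ∃ p q r : Fin A.size, t = ((p : ℕ), (q : ℕ), (r : ℕ)) := by
  obtain ⟨p, q, r⟩ := t
  simp [Code.triples, Code.states, Fin.exists_iff]

theorem isBranching_code (q : Fin A.size) :
    A.code.isBranching q = true ↔ q ∈ branchingStates A.toDFA := by
  rw [Code.isBranching, Bool.not_eq_true', ← Bool.not_eq_true, any_states_code]
  refine not_congr (exists_congr fun m => ?_)
  rw [Bool.and_eq_true, all_states_code, lt_code]
  refine and_congr Iff.rfl (forall_congr' fun x => ?_)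
  rw [not_or_eq_true_iff, lt_code, le_code]
  rfl

theorem isSeparator_code (s : Fin A.size) :
    A.code.isSeparator s = true ↔ IsSeparatorState A.toDFA s := by
  rw [Code.isSeparator, Bool.and_eq_true, all_states_code, isBranching_code]
  refine and_congr Iff.rfl (forall_congr' fun x => ?_)
  rw [not_or_eq_true_iff, isBranching_code, le_code]

theorem isNextSeparator_code (r : Fin A.size) : A.code.isNextSeparator r = true ↔
    ∃ s, IsSeparatorState A.toDFA s ∧ IsNext A.toDFA s r := by
  rw [Code.isNextSeparator, any_states_code]
  simp [isSeparator_code]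

theorem inFamily_code (r q : Fin A.size) :
    A.code.inFamily r q = true ↔ q ∈ family A.toDFA r := by
  simp [Code.inFamily, family]

theorem familySource_code (r q s : Fin A.size) (a : Fin k) :
    A.code.familySource r q a s = true ↔ s ∈ {t | t ∈ family A.toDFA r ∧ Le A.toDFA q t ∧
      A.toDFA.step t a ∈ family A.toDFA r} := by
  rw [Code.familySource, Bool.and_eq_true, Bool.and_eq_true, inFamily_code, le_code, step_code,
    inFamily_code]
  rfl

variable {A}

/-- A least state is unique by antisymmetry, so the search can only find the source used by `C`. -/
theorem familyStep_code (h : IsReducedIdeal A.toDFA) {r : Fin A.size}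
    {C : DFA (Fin k) (family A.toDFA r)} (hC : IsFamilyAutomaton A.toDFA r C)
    (q : family A.toDFA r) (a : Fin k) :
    A.code.familyStep r (q : Fin A.size) a = ((C.step q a : Fin A.size) : ℕ) := by
  have hleast : ∀ s : Fin A.size, A.code.isLeastSource r (q : Fin A.size) a s = true ↔
        IsLeastState A.toDFA {t | t ∈ family A.toDFA r ∧ Le A.toDFA q t ∧
          A.toDFA.step t a ∈ family A.toDFA r} s := by
    intro s
    rw [Code.isLeastSource, Bool.and_eq_true, all_states_code, familySource_code]
    refine and_congr Iff.rfl (forall_congr' fun x => ?_)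
    rw [not_or_eq_true_iff, familySource_code, le_code]
  obtain ⟨s, hs, he⟩ := hC.2.2 q a
  obtain ⟨hmem, hsat⟩ := firstSat_spec
    (p := fun s => A.code.isLeastSource r (q : Fin A.size) a s) (List.mem_range.2 s.2) ((hleast s).2 hs)
  rw [Code.familyStep, Code.states, size_code]
  generalize firstSat (List.range A.size) _ = x at hmem hsat ⊢
  lift x to Fin A.size using List.mem_range.1 hmem with s'
  rw [hleast] at hsat
  rw [step_code, he,
    h.antisymm (hs.2 s' hsat.1) (hsat.2 s hs.1)]

theorem familyAccepts_code (h : IsReducedIdeal A.toDFA) {r : Fin A.size}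
    {C : DFA (Fin k) (family A.toDFA r)} (hC : IsFamilyAutomaton A.toDFA r C) (w : List (Fin k)) :
    A.code.familyAccepts r (w.map Fin.val) = true ↔ w ∈ C.accepts := by
  have hrun : ∀ (w : List (Fin k)) (q : family A.toDFA r),
      (w.map Fin.val).foldl (fun q a => A.code.familyStep r q a) ((q : Fin A.size) : ℕ) =
        ((C.evalFrom q w : Fin A.size) : ℕ) := by
    intro w
    induction w with
    | nil => exact fun q => rfl
    | cons a w ih =>
      intro q
      rw [List.map_cons, List.foldl_cons, familyStep_code h hC, ih, DFA.evalFrom_cons]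
  rw [Code.familyAccepts, start_code, ← hC.1, hrun, accepting_code, ← hC.2.1]
  rfl

theorem reducedAccepts_code {q r : Fin A.size} {C : DFA (Fin k) {x : Fin A.size // x ≠ q}}
    (hC : IsReducedAutomaton A.toDFA q r C) (w : List (Fin k)) :
    A.code.reducedAccepts q r (w.map Fin.val) = true ↔ w ∈ C.accepts := by
  have hred : ∀ x y : Fin A.size, ((x = q ∧ y = r) ∨ (x ≠ q ∧ y = x)) →
      Code.redirect q r x = (y : ℕ) := by
    rintro x y (⟨rfl, rfl⟩ | ⟨hx, rfl⟩)
    · simp [Code.redirect]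
    · have : ((y : ℕ) == (q : ℕ)) = false := by simpa [Fin.val_inj] using hx
      simp [Code.redirect, this]
  have hrun : ∀ (w : List (Fin k)) (x : {x : Fin A.size // x ≠ q}),
      (w.map Fin.val).foldl (fun x a => Code.redirect q r (A.code.step x a))
        ((x : Fin A.size) : ℕ) = ((C.evalFrom x w : Fin A.size) : ℕ) := by
    intro w
    induction w with
    | nil => exact fun q => rfl
    | cons a w ih =>
      intro x
      rw [List.map_cons, List.foldl_cons, step_code, hred _ _ (hC.2.2 x a), ih, DFA.evalFrom_cons]
  rw [Code.reducedAccepts, start_code, hred _ _ hC.1, hrun, accepting_code, ← hC.2.1]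
  rfl

theorem code_mem_candidates {n : ℕ} (hn : A.size ≤ n) : A.code ∈ Code.candidates k n := by
  simp only [Code.candidates, List.mem_flatMap, List.mem_map, List.mem_range, mem_listsOfLength]
  refine ⟨A.size, by omega, A.start, A.start.2, _, ⟨List.length_ofFn, by simp⟩, _,
    ⟨List.length_ofFn, fun l hl => ?_⟩, rfl⟩
  obtain ⟨q, rfl⟩ := List.mem_ofFn.1 hl
  refine ⟨List.length_ofFn, fun x hx => ?_⟩
  obtain ⟨a, rfl⟩ := List.mem_ofFn.1 hx
  exact (A.step q a).2

theorem exists_code_eq_of_mem_candidates {n : ℕ} {c : Code} (hc : c ∈ Code.candidates k n) :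
    ∃ B : FinAut (Fin k), B.size ≤ n ∧ B.code = c := by
  simp only [Code.candidates, List.mem_flatMap, List.mem_map, List.mem_range,
    mem_listsOfLength] at hc
  obtain ⟨m, hm, i, hi, F, ⟨rfl, -⟩, T, ⟨hT, hTm⟩, rfl⟩ := hc
  have hrow : ∀ q : Fin F.length, (T[q]'(by omega)).length = k ∧
      ∀ x ∈ T[q]'(by omega), x < F.length := fun q => hTm _ (List.getElem_mem _)
  refine ⟨⟨F.length, fun q a => ⟨(T[q]'(by omega))[a]'(by have := (hrow q).1; omega),
    (hrow q).2 _ (List.getElem_mem _)⟩, ⟨i, hi⟩,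
    Finset.univ.filter fun q => F[q] = true⟩, Nat.lt_succ_iff.1 hm, ?_⟩
  simp only [code, Prod.mk.injEq, true_and]
  constructor
  · refine List.ext_getElem (by simp) fun j h₁ h₂ => ?_
    simp
  · refine List.ext_getElem (by simp [hT]) fun j h₁ h₂ => ?_
    refine List.ext_getElem ?_ fun l h₃ h₄ => ?_
    · simp at h₁
      simpa using (hrow ⟨j, h₁⟩).1.symm
    · simp

/-- Both automata have at most `n` states, so words of length up to `n * n` decide equality of
languages. -/
theorem agrees_code_iff {B : FinAut (Fin k)} {σ : Type} [Finite σ] {M : DFA (Fin k) σ} {n : ℕ}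
    (hB : B.size ≤ n) (hM : Nat.card σ ≤ n) {p : List ℕ → Bool}
    (hp : ∀ w : List (Fin k), p (w.map Fin.val) = true ↔ w ∈ M.accepts) :
    Code.agrees B.code ((wordsUpTo k (n * n)).map fun w => (w, p w)) = true ↔
      B.language = M.accepts := by
  have := Fintype.ofFinite σ
  have hacc : ∀ w : List (Fin k),
      B.code.accepting (B.code.run B.code.start (w.map Fin.val)) = true ↔ w ∈ B.language := by
    intro w
    rw [start_code, run_code, accepting_code]
    rfl
  simp only [Code.agrees, List.all_eq_true, List.mem_map, beq_iff_eq, forall_exists_index,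
    and_imp, forall_apply_eq_imp_iff₂]
  constructor
  · refine fun H => accepts_eq_of_bounded B.toDFA M fun w hw => ?_
    rw [Fintype.card_fin, ← Nat.card_eq_fintype_card] at hw
    have := H (w.map Fin.val)
      (map_val_mem_wordsUpTo.2 (hw.le.trans (Nat.mul_le_mul hB hM)))
    rw [Bool.eq_iff_iff, hacc, hp] at this
    exact this
  · intro H w hw
    obtain ⟨v, rfl⟩ := exists_map_val_eq (mem_wordsUpTo.1 hw).2
    rw [Bool.eq_iff_iff, hacc, hp, H]

/-- Some minimal automaton of the language has at most `n` states, so the smallest agreeing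
candidate is minimal among all automata. -/
theorem exists_code_eq_smallest {σ : Type} [Finite σ] {M : DFA (Fin k) σ} {n : ℕ}
    (hM : Nat.card σ ≤ n) {p : List ℕ → Bool}
    (hp : ∀ w : List (Fin k), p (w.map Fin.val) = true ↔ w ∈ M.accepts) :
    ∃ B : FinAut (Fin k), B.IsMinimal ∧ B.language = M.accepts ∧
      B.code = Code.smallest k n ((wordsUpTo k (n * n)).map fun w => (w, p w)) := by
  have hsat : ∀ B : FinAut (Fin k), B.size ≤ n →
      (Code.isSmallest k n ((wordsUpTo k (n * n)).map fun w => (w, p w)) B.code = true ↔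
      B.language = M.accepts ∧ ∀ B' : FinAut (Fin k), B'.size ≤ n → B'.language = M.accepts →
        B.size ≤ B'.size) := by
    intro B hB
    rw [Code.isSmallest, Bool.and_eq_true, agrees_code_iff hB hM hp, List.all_eq_true]
    refine and_congr_right fun _ => ⟨fun H B' hB' hL => ?_, fun H c hc => ?_⟩
    · have := H B'.code (code_mem_candidates hB')
      rw [not_or_eq_true_iff, agrees_code_iff hB' hM hp, decide_eq_true_iff] at this
      exact this hL
    · obtain ⟨B', hB', rfl⟩ := exists_code_eq_of_mem_candidates hc
      rw [not_or_eq_true_iff, agrees_code_iff hB' hM hp, decide_eq_true_iff]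
      exact H B' hB'
  obtain ⟨B₀, hB₀, hL₀⟩ := FinAut.exists_isMinimal_of_dfa M
  have hs₀ := (hB₀.size_le hL₀).trans hM
  obtain ⟨hmem, hs⟩ := firstSat_spec (p := fun B => Code.isSmallest k n _ B)
    (code_mem_candidates hs₀)
    ((hsat B₀ hs₀).2 ⟨hL₀, fun B' _ hL => hB₀ B' (hL.trans hL₀.symm)⟩)
  obtain ⟨B, hB, he⟩ := exists_code_eq_of_mem_candidates hmem
  rw [← he] at hs
  obtain ⟨hL, hmin⟩ := (hsat B hB).1 hs
  exact ⟨B, fun B' hB' => (hmin B₀ hs₀ hL₀).trans (hB₀ B' (hB'.trans (hL.trans hL₀.symm))), hL, he⟩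

end FinAut

/-! ### Correctness of the iterated procedure -/

namespace Code

/-- Rounds act on the members independently, so iterating over a list is iterating on each member.
-/
theorem iterate_decompose_eq (n : ℕ) (D : List Code) :
    (fun D => D.flatMap fun c => decompose c)^[n] D = D.flatMap (iterateDecompose n) := by
  induction n generalizing D with
  | zero => exact (List.flatMap_singleton' D).symm
  | succ n ih =>
    rw [Function.iterate_succ_apply, ih, List.flatMap_assoc]
    refine congrArg (fun f => D.flatMap f) (funext fun c => ?_)
    rw [iterateDecompose, Function.iterate_succ_apply, ih]
    simp

theorem iterateDecompose_succ (n : ℕ) (c : Code) :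
    iterateDecompose (n + 1) c = c.decompose.flatMap (iterateDecompose n) := by
  rw [iterateDecompose, Function.iterate_succ_apply, iterate_decompose_eq]
  simp

/-- Finished members survive superfluous rounds, so all branches can use the same number of rounds.
-/
theorem iterateDecompose_of_decompose_eq {c : Code} (hc : c.decompose = [c]) (n : ℕ) :
    iterateDecompose n c = [c] :=
  Function.iterate_fixed (by simp [hc]) n

end Code

/-- `D` is an output of the iterated procedure on `A` with all the expected properties. -/
structure IsPrimeOutput {α : Type} (A : FinAut α) (D : List (FinAut α)) : Prop where
  decomposition : IteratedDecomposition A D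
  length_le : D.length ≤ 2 ^ (2 * A.size)
  prime : ∀ B ∈ D, B.IsInterPrime ∧ IsIdeal B.language
  intersection : A.IsIntersection D
  ne_nil : D ≠ []
  eq_or_lt : (A.IsInterPrime ∧ D = [A]) ∨ ∀ B ∈ D, B.size < A.size

theorem IsPrimeOutput.size_le {α : Type} {A : FinAut α} {D : List (FinAut α)}
    (h : IsPrimeOutput A D) : ∀ B ∈ D, B.size ≤ A.size := by
  intro B hB
  rcases h.eq_or_lt with ⟨-, rfl⟩ | hlt
  · rw [List.mem_singleton.1 hB]
  · exact (hlt B hB).le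

/-- One replacement step of the length bound: `t` parts of size `s`, absorbed through `t ≤ 4 ^ (t -
1)` for `t ≥ 1`. -/
theorem mul_two_pow_le {t s m : ℕ} (h : s + t ≤ m + 1) : t * 2 ^ (2 * s) ≤ 2 ^ (2 * m) := by
  rcases t with _ | t
  · simp
  · calc (t + 1) * 2 ^ (2 * s) ≤ 2 ^ (2 * t) * 2 ^ (2 * s) := by
          refine Nat.mul_le_mul_right _ ?_
          have : 2 * t < 2 ^ (2 * t) := Nat.lt_two_pow_self
          omega
      _ = 2 ^ (2 * (t + s)) := by rw [mul_add, pow_add]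
      _ ≤ 2 ^ (2 * m) := Nat.pow_le_pow_right (by norm_num) (by omega)

namespace FinAut

variable {k : ℕ} {A : FinAut (Fin k)}

theorem isPrimeOutput_of_no_damping (hA : A.IsMinimal) (hI : IsIdeal A.language)
    (hlin : IsLinear A.toDFA) (hd : ¬ ∃ p q r, IsDampingPattern A.toDFA p q r) :
    IsPrimeOutput A [A] where
  decomposition := .linearNoDamping A hlin hd
  length_le := Nat.one_le_two_pow
  prime B hB := by
    rw [List.mem_singleton.1 hB]
    exact ⟨isInterPrime_of_no_damping hA hI hlin hd, hI⟩
  intersection w := by simp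
  ne_nil := by simp
  eq_or_lt := Or.inl ⟨isInterPrime_of_no_damping hA hI hlin hd, rfl⟩

theorem decompose_code_of_no_damping (h : IsReducedIdeal A.toDFA)
    (hlin : IsLinear A.toDFA) (hd : ¬ ∃ p q r, IsDampingPattern A.toDFA p q r) :
    A.code.decompose = [A.code] := by
  have : (A.code.triples.any fun t => A.code.isDamping t) = false := by
    rw [← Bool.not_eq_true, List.any_eq_true]
    rintro ⟨t, ht, hdt⟩
    obtain ⟨p, q, r, rfl⟩ := A.mem_triples_code.1 ht
    exact hd ⟨p, q, r, (A.isDamping_code p q r).1 hdt⟩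
  rw [Code.decompose, (A.isLinear_code h).2 hlin, this]
  rfl

theorem exists_decompose_code_of_damping (hA : A.IsMinimal) (hI : IsIdeal A.language)
    (hlin : IsLinear A.toDFA) (hd : ∃ p q r, IsDampingPattern A.toDFA p q r) :
    ∃ p q r, IsDampingPattern A.toDFA p q r ∧ ∃ C₁ C₂, IsReducedAutomaton A.toDFA p q C₁ ∧
      IsReducedAutomaton A.toDFA q r C₂ ∧ ∃ B₁ B₂ : FinAut (Fin k),
        (B₁.IsMinimal ∧ B₁.language = C₁.accepts) ∧ (B₂.IsMinimal ∧ B₂.language = C₂.accepts) ∧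
        A.code.decompose = [B₁.code, B₂.code] := by
  obtain ⟨p, q, r, hpqr⟩ := hd
  have hmem := A.mem_triples_code.2 ⟨p, q, r, rfl⟩
  have hsat := (A.isDamping_code p q r).2 hpqr
  obtain ⟨hmem', hsat'⟩ := firstSat_spec (p := fun t => A.code.isDamping t) hmem hsat
  obtain ⟨p', q', r', he⟩ := A.mem_triples_code.1 hmem'
  rw [he] at hsat'
  have hd := (A.isDamping_code p' q' r').1 hsat'
  obtain ⟨C₁, hC₁⟩ := exists_isReducedAutomaton A.toDFA (Ne.symm hd.1.1.2)
  obtain ⟨C₂, hC₂⟩ := exists_isReducedAutomaton A.toDFA (Ne.symm hd.2.1.1.2)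
  have hcard : ∀ q : Fin A.size, Nat.card {x : Fin A.size // x ≠ q} ≤ A.size := fun q =>
    (Nat.card_le_card_of_injective _ Subtype.val_injective).trans (by simp)
  obtain ⟨B₁, hB₁, hL₁, hc₁⟩ := exists_code_eq_smallest (hcard p')
    (p := A.code.reducedAccepts p' q') (reducedAccepts_code hC₁)
  obtain ⟨B₂, hB₂, hL₂, hc₂⟩ := exists_code_eq_smallest (hcard q')
    (p := A.code.reducedAccepts q' r') (reducedAccepts_code hC₂)
  refine ⟨p', q', r', hd, C₁, C₂, hC₁, hC₂, B₁, B₂, ⟨hB₁, hL₁⟩, ⟨hB₂, hL₂⟩, ?_⟩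
  rw [Code.decompose, (A.isLinear_code (hA.isReducedIdeal hI)).2 hlin,
    List.any_eq_true.2 ⟨_, hmem, hsat⟩, he, hc₁, hc₂]
  rfl

theorem size_lt_of_reduced {q : Fin A.size} {C : DFA (Fin k) {x : Fin A.size // x ≠ q}}
    {B : FinAut (Fin k)} (hB : B.IsMinimal ∧ B.language = C.accepts) : B.size < A.size := by
  have := Finite.card_subtype_lt (p := fun x : Fin A.size => x ≠ q) (x := q) (by simp)
  rw [Nat.card_fin] at this
  exact (hB.1.size_le hB.2).trans_lt this

theorem isPrimeOutput_of_damping (hA : A.IsMinimal) (hI : IsIdeal A.language)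
    (hlin : IsLinear A.toDFA) {p q r : Fin A.size} (hd : IsDampingPattern A.toDFA p q r)
    {C₁ : DFA (Fin k) _} {C₂ : DFA (Fin k) _} (hC₁ : IsReducedAutomaton A.toDFA p q C₁)
    (hC₂ : IsReducedAutomaton A.toDFA q r C₂) {B₁ B₂ : FinAut (Fin k)}
    (hB₁ : B₁.IsMinimal ∧ B₁.language = C₁.accepts) (hB₂ : B₂.IsMinimal ∧ B₂.language = C₂.accepts)
    {D₁ D₂ : List (FinAut (Fin k))} (hD₁ : IsPrimeOutput B₁ D₁) (hD₂ : IsPrimeOutput B₂ D₂) :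
    IsPrimeOutput A (D₁ ++ D₂) := by
  have hs₁ := size_lt_of_reduced hB₁
  have hs₂ := size_lt_of_reduced hB₂
  -- Two parts, each missing at least one state.
  have hA1 : 2 * 2 ^ (2 * (A.size - 1)) ≤ 2 ^ (2 * A.size) := mul_two_pow_le (by omega)
  refine ⟨.linear A hlin p q r hd B₁ B₂ D₁ D₂ ⟨hB₁.1, C₁, hC₁, hB₁.2⟩ ⟨hB₂.1, C₂, hC₂, hB₂.2⟩
    hD₁.decomposition hD₂.decomposition, ?_, ?_, ?_, ?_, Or.inr ?_⟩
  · have h₁ := hD₁.length_le.trans (Nat.pow_le_pow_right (n := 2) (by norm_num)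
      (by omega : 2 * B₁.size ≤ 2 * (A.size - 1)))
    have h₂ := hD₂.length_le.trans (Nat.pow_le_pow_right (n := 2) (by norm_num)
      (by omega : 2 * B₂.size ≤ 2 * (A.size - 1)))
    rw [List.length_append]
    omega
  · intro B hB
    exact (List.mem_append.1 hB).elim (hD₁.prime B) (hD₂.prime B)
  · intro w
    rw [List.forall_mem_append, ← hD₁.intersection, ← hD₂.intersection, hB₁.2, hB₂.2]
    exact (hA.isReducedIdeal hI).mem_accepts_iff_reduced hd hC₁ hC₂ hlin w
  · simp [hD₁.ne_nil]
  · intro B hB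
    rcases List.mem_append.1 hB with hB | hB
    · have := hD₁.size_le B hB
      omega
    · have := hD₂.size_le B hB
      omega

theorem exists_decompose_code_of_not_linear (hA : A.IsMinimal) (hI : IsIdeal A.language)
    (hlin : ¬ IsLinear A.toDFA) :
    ∃ seps : List (Fin A.size), seps.Nodup ∧ (∀ ρ, ρ ∈ seps ↔ ρ ∈ separatorSet A.toDFA) ∧
      ∃ B : Fin A.size → FinAut (Fin k), (∀ ρ ∈ seps, (B ρ).IsMinimal ∧
        ∃ C, IsFamilyAutomaton A.toDFA ρ C ∧ (B ρ).language = C.accepts) ∧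
        A.code.decompose = seps.map fun ρ => (B ρ).code := by
  have h := hA.isReducedIdeal hI
  obtain ⟨s, hs⟩ := h.exists_isSeparatorState
  have hseps : ∀ ρ, A.code.isNextSeparator (ρ : Fin A.size) = true ↔ IsNext A.toDFA s ρ := by
    intro ρ
    rw [isNextSeparator_code]
    refine ⟨?_, fun hρ => ⟨s, hs, hρ⟩⟩
    rintro ⟨s', hs', hρ⟩
    exact h.separator_unique hs hs' ▸ hρ
  have hB : ∀ ρ : Fin A.size, ∃ B : FinAut (Fin k), IsNext A.toDFA s ρ → B.IsMinimal ∧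
      (∃ C, IsFamilyAutomaton A.toDFA ρ C ∧ B.language = C.accepts) ∧
      B.code = A.code.minimizedFamily ρ := by
    intro ρ
    by_cases hρ : IsNext A.toDFA s ρ
    · obtain ⟨C, hC⟩ := h.exists_isFamilyAutomaton hs hρ
      have hcard : Nat.card (family A.toDFA ρ) ≤ A.size :=
        (Nat.card_le_card_of_injective _ Subtype.val_injective).trans (by simp)
      obtain ⟨B, hB, hL, hc⟩ := exists_code_eq_smallest hcard
        (p := A.code.familyAccepts ρ) (familyAccepts_code h hC)
      exact ⟨B, fun _ => ⟨hB, ⟨C, hC, hL⟩, hc⟩⟩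
    -- An arbitrary value outside the separator set.
    · exact ⟨A, fun hρ' => absurd hρ' hρ⟩
  choose B hB using hB
  refine ⟨(List.finRange A.size).filter fun ρ => A.code.isNextSeparator ρ,
    (List.nodup_finRange _).filter _, fun ρ => ?_, B, fun ρ hρ => ?_, ?_⟩
  · rw [h.mem_separatorSet_iff hs, ← hseps]
    simp
  · have := hB ρ ((hseps ρ).1 (List.mem_filter.1 hρ).2)
    exact ⟨this.1, this.2.1⟩
  · have hl : A.code.isLinear = false := by
      rwa [← Bool.not_eq_true, isLinear_code A h]
    rw [Code.decompose, hl, cond_false, Code.states, size_code, ← List.map_coe_finRange_eq_range,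
      List.filter_map, List.map_map]
    refine List.map_congr_left fun ρ hρ => ?_
    exact (hB ρ ((hseps ρ).1 (List.mem_filter.1 hρ).2)).2.2.symm

theorem size_add_length_le_of_family (hA : A.IsMinimal) (hI : IsIdeal A.language)
    (hlin : ¬ IsLinear A.toDFA) {seps : List (Fin A.size)} (hnodup : seps.Nodup)
    (hseps : ∀ ρ, ρ ∈ seps ↔ ρ ∈ separatorSet A.toDFA) {B : Fin A.size → FinAut (Fin k)}
    (hB : ∀ ρ ∈ seps, (B ρ).IsMinimal ∧
      ∃ C, IsFamilyAutomaton A.toDFA ρ C ∧ (B ρ).language = C.accepts) :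
    2 ≤ seps.length ∧ ∀ ρ ∈ seps, (B ρ).size + seps.length ≤ A.size + 1 := by
  have h := hA.isReducedIdeal hI
  obtain ⟨s, hs⟩ := h.exists_isSeparatorState
  have hmem : ∀ ρ, ρ ∈ seps ↔ IsNext A.toDFA s ρ := fun ρ =>
    (hseps ρ).trans (h.mem_separatorSet_iff hs)
  obtain ⟨ρ₀, hρ₀⟩ := h.exists_isNext_separator hlin hs
  obtain ⟨ρ₁, hρ₁, hne⟩ := h.exists_isNext_ne hs hρ₀
  have hfin : seps.toFinset.card = seps.length := List.toFinset_card_of_nodup hnodup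
  refine ⟨?_, fun ρ hρ => ?_⟩
  · rw [← hfin]
    exact Finset.one_lt_card.2 ⟨ρ₀, by simp [hmem, hρ₀], ρ₁, by simp [hmem, hρ₁], hne.symm⟩
  · obtain ⟨hmin, C, hC, hL⟩ := hB ρ hρ
    have h₁ := hmin.size_le hL
    have h₂ := IsReducedIdeal.card_family_add_card_le (X := seps.toFinset) (r := ρ)
      (fun x hx => (hmem x).1 (List.mem_toFinset.1 hx)) (List.mem_toFinset.2 hρ)
    rw [hfin, Fintype.card_fin] at h₂
    omega

theorem isPrimeOutput_of_not_linear (hA : A.IsMinimal) (hI : IsIdeal A.language)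
    (hlin : ¬ IsLinear A.toDFA) {seps : List (Fin A.size)} (hnodup : seps.Nodup)
    (hseps : ∀ ρ, ρ ∈ seps ↔ ρ ∈ separatorSet A.toDFA) {B : Fin A.size → FinAut (Fin k)}
    (hB : ∀ ρ ∈ seps, (B ρ).IsMinimal ∧
      ∃ C, IsFamilyAutomaton A.toDFA ρ C ∧ (B ρ).language = C.accepts)
    {D : Fin A.size → List (FinAut (Fin k))} (hD : ∀ ρ ∈ seps, IsPrimeOutput (B ρ) (D ρ)) :
    IsPrimeOutput A (seps.flatMap D) := by
  have h := hA.isReducedIdeal hI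
  obtain ⟨s, hs⟩ := h.exists_isSeparatorState
  have hmem : ∀ ρ, ρ ∈ seps ↔ IsNext A.toDFA s ρ := fun ρ =>
    (hseps ρ).trans (h.mem_separatorSet_iff hs)
  obtain ⟨ρ₀, hρ₀⟩ := h.exists_isNext_separator hlin hs
  obtain ⟨htwo, hsize⟩ := size_add_length_le_of_family hA hI hlin hnodup hseps hB
  refine ⟨.nonLinear A hlin seps hnodup hseps B D hB fun ρ hρ => (hD ρ hρ).decomposition,
    ?_, ?_, ?_, ?_, Or.inr ?_⟩
  -- With `t` successors, each part has at most `A.size + 1 - t` states.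
  · have hle : ∀ x ∈ seps.map fun ρ => (D ρ).length, x ≤ 2 ^ (2 * (A.size + 1 - seps.length)) := by
      intro x hx
      obtain ⟨ρ, hρ, rfl⟩ := List.mem_map.1 hx
      have := hsize ρ hρ
      exact (hD ρ hρ).length_le.trans (Nat.pow_le_pow_right (by norm_num) (by omega))
    have := List.sum_le_card_nsmul _ _ hle
    rw [List.length_map, smul_eq_mul] at this
    have hpos := hsize ρ₀ ((hmem ρ₀).2 hρ₀)
    rw [List.length_flatMap]
    exact this.trans (mul_two_pow_le (by omega))
  · intro C hC
    obtain ⟨ρ, hρ, hC⟩ := List.mem_flatMap.1 hC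
    exact (hD ρ hρ).prime C hC
  · intro w
    have hiff : (∀ C ∈ seps.flatMap D, w ∈ C.language) ↔ ∀ ρ ∈ seps, w ∈ (B ρ).language := by
      simp only [List.mem_flatMap, forall_exists_index, and_imp]
      exact ⟨fun H ρ hρ => ((hD ρ hρ).intersection w).2 fun C hC => H C ρ hρ hC,
        fun H C ρ hρ hC => ((hD ρ hρ).intersection w).1 (H ρ hρ) C hC⟩
    rw [hiff]
    constructor
    · intro hw ρ hρ
      obtain ⟨-, C, hC, hL⟩ := hB ρ hρ
      exact hL ▸ h.accepts_le_family hC w hw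
    · intro H
      refine (h.mem_accepts_iff_family hs ⟨ρ₀, hρ₀⟩ w).2 fun ρ hρ => ?_
      obtain ⟨-, C, hC, hL⟩ := hB ρ ((hmem ρ).2 hρ)
      exact ⟨C, hC, hL ▸ H ρ ((hmem ρ).2 hρ)⟩
  · have hρ₀' := (hmem ρ₀).2 hρ₀
    obtain ⟨C, hC⟩ := List.exists_mem_of_ne_nil _ (hD ρ₀ hρ₀').ne_nil
    exact List.ne_nil_of_mem (List.mem_flatMap.2 ⟨ρ₀, hρ₀', hC⟩)
  · intro C hC
    obtain ⟨ρ, hρ, hC⟩ := List.mem_flatMap.1 hC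
    have := (hD ρ hρ).size_le C hC
    have := hsize ρ hρ
    omega

/-- Each round either leaves an automaton unchanged or replaces it by strictly smaller ones, so
`A.size` rounds are enough; zero rounds never occur, since automata have a state. -/
theorem exists_iterateDecompose_code (n : ℕ) (hn : A.size ≤ n) (hA : A.IsMinimal)
    (hI : IsIdeal A.language) :
    ∃ D, A.code.iterateDecompose n = D.map code ∧ IsPrimeOutput A D := by
  induction n generalizing A with
  | zero =>
    have := A.start.pos
    omega
  | succ n ih =>
  have h := hA.isReducedIdeal hI
  by_cases hlin : IsLinear A.toDFA
  · by_cases hd : ∃ p q r, IsDampingPattern A.toDFA p q r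
    · obtain ⟨p, q, r, hd, C₁, C₂, hC₁, hC₂, B₁, B₂, hB₁, hB₂, hdec⟩ :=
        exists_decompose_code_of_damping hA hI hlin hd
      have hs₁ := size_lt_of_reduced hB₁
      have hs₂ := size_lt_of_reduced hB₂
      obtain ⟨D₁, he₁, hD₁⟩ := ih (by omega) hB₁.1 (hB₁.2 ▸ h.isIdeal_reduced hd.1 hC₁ hlin)
      obtain ⟨D₂, he₂, hD₂⟩ := ih (by omega) hB₂.1 (hB₂.2 ▸ h.isIdeal_reduced hd.2.1 hC₂ hlin)
      refine ⟨D₁ ++ D₂, ?_, isPrimeOutput_of_damping hA hI hlin hd hC₁ hC₂ hB₁ hB₂ hD₁ hD₂⟩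
      rw [Code.iterateDecompose_succ, hdec]
      simp [he₁, he₂]
    · exact ⟨[A], Code.iterateDecompose_of_decompose_eq (decompose_code_of_no_damping h hlin hd) _,
        isPrimeOutput_of_no_damping hA hI hlin hd⟩
  · obtain ⟨seps, hnodup, hseps, B, hB, hdec⟩ := exists_decompose_code_of_not_linear hA hI hlin
    obtain ⟨htwo, hsize⟩ := size_add_length_le_of_family hA hI hlin hnodup hseps hB
    obtain ⟨s, hs⟩ := h.exists_isSeparatorState
    have hD : ∀ ρ, ∃ D, ρ ∈ seps → (B ρ).code.iterateDecompose n = D.map code ∧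
        IsPrimeOutput (B ρ) D := by
      intro ρ
      by_cases hρ : ρ ∈ seps
      · obtain ⟨hmin, C, hC, hL⟩ := hB ρ hρ
        have hr := (h.mem_separatorSet_iff hs).1 ((hseps ρ).1 hρ)
        have := hsize ρ hρ
        obtain ⟨D, hD⟩ := ih (by omega) hmin (hL ▸ h.isIdeal_family hC hs hr)
        exact ⟨D, fun _ => hD⟩
      · exact ⟨[], fun hρ' => absurd hρ' hρ⟩
    choose D hD using hD
    refine ⟨seps.flatMap D, ?_, isPrimeOutput_of_not_linear hA hI hlin hnodup hseps hB
      fun ρ hρ => (hD ρ hρ).2⟩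
    rw [Code.iterateDecompose_succ, hdec, List.flatMap_map, List.map_flatMap,
      List.flatMap_def, List.flatMap_def]
    exact congrArg _ (List.map_congr_left fun ρ hρ => (hD ρ hρ).1)

end FinAut
end IdealAutomata

theorem mainTheorem9 :
    ∃ f : IdealAutomata.Code → List IdealAutomata.Code, Computable f ∧
      ∀ (k : ℕ) (A : IdealAutomata.FinAut (Fin k)),
        A.IsMinimal → IdealAutomata.IsIdeal A.language →
        ∃ D : List (IdealAutomata.FinAut (Fin k)),
          f A.code = D.map IdealAutomata.FinAut.code ∧
          IdealAutomata.IteratedDecomposition A D ∧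
          D.length ≤ 2 ^ (2 * A.size) ∧
          (∀ B ∈ D, B.IsInterPrime ∧ IdealAutomata.IsIdeal B.language) ∧
          A.IsIntersection D ∧
          (A.IsInterPrime → D = [A]) ∧
          (¬ A.IsInterPrime → A.IsInterDecomposition D) := by
  refine ⟨fun c => c.iterateDecompose c.size, (IdealAutomata.Code.primrec_iterateDecompose
    Primrec.id (IdealAutomata.Code.primrec_size Primrec.id)).to_comp, fun k A hA hI => ?_⟩
  obtain ⟨D, hD, h⟩ := IdealAutomata.FinAut.exists_iterateDecompose_code A.size le_rfl hA hI
  refine ⟨D, hD, h.decomposition, h.length_le, h.prime, h.intersection, fun hp => ?_, fun hp => ?_⟩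
  · rcases h.eq_or_lt with ⟨-, hDA⟩ | hlt
    · exact hDA
    -- Strictly smaller members would form a decomposition of a prime automaton.
    · exact absurd ⟨D, h.ne_nil, hlt, h.intersection⟩ hp.2
  · exact ⟨h.ne_nil, h.eq_or_lt.resolve_left fun hDA => hp hDA.1, h.intersection⟩
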